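/- Let $G\subset\mathbb{P}^5$ be a smooth quadric over $\mathbb{C}$, let $F\subset\mathbb{P}^5$ be a quadric different from $G$, and let $X=F\cap G$ be their complete intersection, i.e. the closed subscheme of $\mathbb{P}^5$ defined by the two equations; such an $X$ is called a quadratic complex. Denote by $F$ and $G$ also symmetric $6\times 6$ matrices defining the two quadrics, and let $\Delta(\lambda,\mu)=\det(\lambda F+\mu G)$, a nonzero binary sextic. For each root $p=(\bar\lambda:\bar\mu)\in\mathbb{P}^1$ of $\Delta$ let $d\ge 0$ be the integer such that all subdeterminants of order $6-d$ of $\lambda F+\mu G$ vanish at $p$, but not all subdeterminants of order $5-d$ do. For $0\le i\le d+1$ let $l_i$ be the minimum multiplicity of the root $p$ in the subdeterminants of order $6-i$ of $\lambda F+\mu G$ (so $l_{d+1}=0$), and put $e_i=l_i-l_{i+1}$ for $0\le i\le d$. The sequence $(e_0,\dots,e_d)$ is the bracket of $p$; its length is $d+1$. The Segre symbol of $X$ is the collection of the brackets of all the roots of $\Delta$. Then: (1) $X$ is non-reduced (as a scheme) if and only if its Segre symbol contains a bracket of length $5$. (2) $X$ is reducible (that is, its underlying topological space is not irreducible) if and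 only if its Segre symbol contains a bracket of length $4$. -/

import Mathlib

noncomputable section

namespace QuadricPencil

open MvPolynomial AlgebraicGeometry
open scoped LinearAlgebra.Projectivization DirectSum

/-! ### Graded quotients of the polynomial ring -/

/-- For an ideal `I` of `ℂ[x₀, …, xₙ₋₁]`, the image in `ℂ[x₀, …, xₙ₋₁] / I` of the space of forms
of degree `d`. -/
def quotientGrading {n : ℕ} (I : Ideal (MvPolynomial (Fin n) ℂ)) (d : ℕ) :
    Submodule ℂ (MvPolynomial (Fin n) ℂ ⧸ I) :=
  (homogeneousSubmodule (Fin n) ℂ d).map (Ideal.Quotient.mkₐ ℂ I).toLinearMap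

theorem mk_mem_quotientGrading {n : ℕ} (I : Ideal (MvPolynomial (Fin n) ℂ)) {d : ℕ}
    {p : MvPolynomial (Fin n) ℂ} (hp : p.IsHomogeneous d) :
    Ideal.Quotient.mk I p ∈ quotientGrading I d :=
  ⟨p, hp, rfl⟩

theorem quotientGrading_gradedMonoid {n : ℕ} (I : Ideal (MvPolynomial (Fin n) ℂ)) :
    SetLike.GradedMonoid (quotientGrading I) where
  one_mem := ⟨1, isHomogeneous_one _ _, map_one (Ideal.Quotient.mkₐ ℂ I)⟩
  mul_mem := by
    rintro i j _ _ ⟨p, hp, rfl⟩ ⟨q, hq, rfl⟩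
    exact ⟨p * q, IsHomogeneous.mul hp hq, map_mul (Ideal.Quotient.mkₐ ℂ I) p q⟩

/-- If the ideal `I` is homogeneous, the quotient is the direct sum of its graded pieces. -/
theorem quotientGrading_isInternal {n : ℕ} (I : Ideal (MvPolynomial (Fin n) ℂ))
    (hI : ∀ p ∈ I, ∀ d, homogeneousComponent d p ∈ I) :
    DirectSum.IsInternal (quotientGrading I) := by
  classical
  constructor
  · rw [injective_iff_map_eq_zero]
    intro x hx
    have hrep : ∀ d, ∃ p : MvPolynomial (Fin n) ℂ, p.IsHomogeneous d ∧
        Ideal.Quotient.mk I p = (x d : MvPolynomial (Fin n) ℂ ⧸ I) := by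
      intro d
      obtain ⟨p, hp, h⟩ := (x d).2
      exact ⟨p, hp, h⟩
    choose p hp hpx using hrep
    rw [DirectSum.coeAddMonoidHom_eq_dfinsuppSum, DFinsupp.sum] at hx
    have hmem : (∑ d ∈ DFinsupp.support x, p d) ∈ I := by
      rw [← Ideal.Quotient.eq_zero_iff_mem, map_sum]
      simp only [hpx]
      exact hx
    ext d
    by_cases hd : d ∈ DFinsupp.support x
    · have h := hI _ hmem d
      rw [map_sum, Finset.sum_eq_single d] at h
      · rw [homogeneousComponent_of_mem (hp d), if_pos rfl] at h
        rw [← hpx d]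
        simpa using Ideal.Quotient.eq_zero_iff_mem.mpr h
      · intro e _ hed
        rw [homogeneousComponent_of_mem (hp e), if_neg (Ne.symm hed)]
      · exact fun h' => absurd hd h'
    · simpa using hd
  · intro y
    obtain ⟨p, rfl⟩ := Ideal.Quotient.mk_surjective y
    refine ⟨∑ d ∈ Finset.range (p.totalDegree + 1),
      DirectSum.of (fun d => quotientGrading I d) d
        ⟨Ideal.Quotient.mk I (homogeneousComponent d p),
          mk_mem_quotientGrading I (homogeneousComponent_isHomogeneous d p)⟩, ?_⟩
    rw [map_sum]
    simp only [DirectSum.coeAddMonoidHom_of]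
    rw [← map_sum, sum_homogeneousComponent]

/-- The grading of the quotient of the polynomial ring by a homogeneous ideal. -/
@[reducible] def quotientGradedAlgebra {n : ℕ} (I : Ideal (MvPolynomial (Fin n) ℂ))
    (hI : ∀ p ∈ I, ∀ d, homogeneousComponent d p ∈ I) :
    GradedAlgebra (quotientGrading I) :=
  { quotientGrading_gradedMonoid I,
    (quotientGrading_isInternal I hI).chooseDecomposition with }

/-! ### Quadratic complexes -/

/-- The quadratic form `∑ᵢⱼ Mᵢⱼ xᵢ xⱼ` of a symmetric matrix `M`; its zero locus is the quadric
in `ℙ⁵` given by `M`. -/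
def quadricForm (M : Matrix (Fin 6) (Fin 6) ℂ) : MvPolynomial (Fin 6) ℂ :=
  ∑ i, ∑ j, C (M i j) * X i * X j

theorem quadricForm_isHomogeneous (M : Matrix (Fin 6) (Fin 6) ℂ) :
    (quadricForm M).IsHomogeneous 2 := by
  refine IsHomogeneous.sum _ _ _ fun i _ => IsHomogeneous.sum _ _ _ fun j _ => ?_
  exact ((isHomogeneous_C _ _).mul (isHomogeneous_X _ _)).mul (isHomogeneous_X _ _)

end QuadricPencil

/-- A quadratic complex, given by the equations (symmetric `6 × 6` matrices) of a smooth, i.e.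
nondegenerate, quadric `G` in `ℙ⁵` over `ℂ` and of a quadric `F` in `ℙ⁵` different from `G`.
Since matrices that differ by a nonzero scalar give the same quadric, and since the zero matrix
gives no quadric, the last condition says that `F` is no scalar multiple of `G`. -/
structure QuadraticComplex where
  /-- the matrix of the smooth quadric -/
  G : Matrix (Fin 6) (Fin 6) ℂ
  /-- the matrix of the second quadric -/
  F : Matrix (Fin 6) (Fin 6) ℂ
  G_symm : G.IsSymm
  F_symm : F.IsSymm
  G_smooth : G.det ≠ 0
  F_ne : ∀ c : ℂ, F ≠ c • G

namespace QuadraticComplex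

open MvPolynomial AlgebraicGeometry QuadricPencil
open scoped LinearAlgebra.Projectivization

variable (X : QuadraticComplex)

/-! ### The complete intersection `F ∩ G` -/

/-- The homogeneous ideal generated by the equations of the quadrics `F` and `G`. -/
def ideal : Ideal (MvPolynomial (Fin 6) ℂ) :=
  Ideal.span {quadricForm X.F, quadricForm X.G}

theorem homogeneousComponent_mem_ideal (p : MvPolynomial (Fin 6) ℂ) (hp : p ∈ X.ideal) (d : ℕ) :
    homogeneousComponent d p ∈ X.ideal := by
  let _ : GradedAlgebra (homogeneousSubmodule (Fin 6) ℂ) := MvPolynomial.gradedAlgebra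
  have h : X.ideal.IsHomogeneous (homogeneousSubmodule (Fin 6) ℂ) := by
    refine Ideal.homogeneous_span _ _ ?_
    rintro _ (rfl | rfl)
    · exact ⟨2, quadricForm_isHomogeneous _⟩
    · exact ⟨2, quadricForm_isHomogeneous _⟩
  rw [← decomposition.decompose'_apply]
  exact h d hp

/-- The homogeneous coordinate ring `ℂ[x₀, …, x₅] / (F, G)` is graded by degree. -/
instance gradedAlgebra : GradedAlgebra (quotientGrading X.ideal) :=
  quotientGradedAlgebra X.ideal X.homogeneousComponent_mem_ideal

/-- The complete intersection `F ∩ G` in `ℙ⁵` as a scheme, `Proj ℂ[x₀, …, x₅] / (F, G)`. -/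
def scheme : Scheme :=
  Proj (quotientGrading X.ideal)

/-- The quadratic complex is non-reduced. -/
def IsNonReduced : Prop :=
  ¬ AlgebraicGeometry.IsReduced X.scheme

/-- The quadratic complex is reducible: the space `F ∩ G` is not irreducible. -/
def IsReducible : Prop :=
  ¬ IrreducibleSpace X.scheme

/-! ### The Segre symbol -/

/-- The matrix `λ F + μ G` of the pencil, where `λ = X 0` and `μ = X 1` are indeterminates. -/
def pencil : Matrix (Fin 6) (Fin 6) (MvPolynomial (Fin 2) ℂ) :=
  (MvPolynomial.X 0 : MvPolynomial (Fin 2) ℂ) • X.F.map C +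
    (MvPolynomial.X 1 : MvPolynomial (Fin 2) ℂ) • X.G.map C

/-- The discriminant `Δ(λ, μ) = det (λ F + μ G)`, a binary sextic. -/
def discriminant : MvPolynomial (Fin 2) ℂ :=
  X.pencil.det

/-- The subdeterminant of order `k` of `λ F + μ G` with the rows `r` and the columns `c`. -/
def minor {k : ℕ} (r c : Fin k ↪o Fin 6) : MvPolynomial (Fin 2) ℂ :=
  (X.pencil.submatrix r c).det

/-- The roots in `ℙ¹` of the discriminant. -/
def roots : Set (ℙ ℂ (Fin 2 → ℂ)) :=
  {p | eval p.rep X.discriminant = 0}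

/-- The binary linear form `λ μ' - λ' μ` with root `p = (λ' : μ')`, up to a nonzero factor. -/
def rootForm (p : ℙ ℂ (Fin 2 → ℂ)) : MvPolynomial (Fin 2) ℂ :=
  C (p.rep 1) * MvPolynomial.X 0 - C (p.rep 0) * MvPolynomial.X 1

/-- The number `lᵢ`: the minimum multiplicity of the root `p` in the subdeterminants of
order `6 - i` (for `i ≤ 6`). Since `Δ ≠ 0`, this minimum is finite. -/
def minMultiplicity (p : ℙ ℂ (Fin 2 → ℂ)) (i : ℕ) : ℕ :=
  (⨅ (r : Fin (6 - i) ↪o Fin 6) (c : Fin (6 - i) ↪o Fin 6),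
    emultiplicity (rootForm p) (X.minor r c)).toNat

/-- The number `d + 1` for which all subdeterminants of order `6 - d` vanish at `p`, but not all
subdeterminants of order `6 - (d + 1)` do. -/
def bracketLength (p : ℙ ℂ (Fin 2 → ℂ)) : ℕ :=
  sInf {k | ∃ r c : Fin (6 - k) ↪o Fin 6, eval p.rep (X.minor r c) ≠ 0}

/-- The bracket `(e₀, …, e_d)` of the root `p`, with the characteristic numbers
`eᵢ = lᵢ - lᵢ₊₁`, where `l_{d+1} = 0`. -/
def bracket (p : ℙ ℂ (Fin 2 → ℂ)) : List ℕ :=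
  (List.range (X.bracketLength p)).map
    fun i => X.minMultiplicity p i - X.minMultiplicity p (i + 1)

theorem finite_roots : X.roots.Finite := by
  classical
  set f : Polynomial ℂ := ((Polynomial.X : Polynomial ℂ) • X.G.map Polynomial.C +
    X.F.map Polynomial.C).det with hf
  have hf0 : f ≠ 0 := by
    intro h
    have hc := Polynomial.coeff_det_X_add_C_card X.G X.F
    rw [← hf, h, Polynomial.coeff_zero] at hc
    exact X.G_smooth hc.symm
  have heval : ∀ v : Fin 2 → ℂ, eval v X.discriminant = (v 0 • X.F + v 1 • X.G).det := by
    intro v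
    rw [discriminant, RingHom.map_det]
    refine congrArg Matrix.det ?_
    ext i j
    simp [pencil]
  have hfeval : ∀ t : ℂ, f.eval t = (t • X.G + X.F).det := by
    intro t
    rw [hf, ← Polynomial.coe_evalRingHom, RingHom.map_det]
    refine congrArg Matrix.det ?_
    ext i j
    simp
    exact mul_comm _ _
  have hne : ∀ t : ℂ, (![1, t] : Fin 2 → ℂ) ≠ 0 := fun t h => by
    simpa using congrFun h 0
  refine ((f.roots.toFinset.finite_toSet).image
    fun t => Projectivization.mk ℂ (![1, t] : Fin 2 → ℂ) (hne t)).subset ?_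
  intro p hp
  have hp' : (p.rep 0 • X.F + p.rep 1 • X.G).det = 0 := (heval _).symm.trans hp
  have h0 : p.rep 0 ≠ 0 := by
    intro h0
    rw [h0, zero_smul, zero_add, Matrix.det_smul] at hp'
    rcases mul_eq_zero.mp hp' with h1 | h1
    · apply p.rep_nonzero
      ext i
      fin_cases i
      · exact h0
      · exact eq_zero_of_pow_eq_zero h1
    · exact X.G_smooth h1
  refine ⟨p.rep 1 / p.rep 0, ?_, ?_⟩
  · simp only [Finset.mem_coe, Multiset.mem_toFinset, Polynomial.mem_roots hf0,
      Polynomial.IsRoot.def, hfeval]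
    have : p.rep 0 • X.F + p.rep 1 • X.G =
        p.rep 0 • ((p.rep 1 / p.rep 0) • X.G + X.F) := by
      rw [smul_add, smul_smul, mul_div_cancel₀ _ h0, add_comm]
    rw [this, Matrix.det_smul] at hp'
    exact (mul_eq_zero.mp hp').resolve_left (pow_ne_zero _ h0)
  · conv_rhs => rw [← p.mk_rep]
    rw [Projectivization.mk_eq_mk_iff']
    refine ⟨(p.rep 0)⁻¹, ?_⟩
    ext i
    fin_cases i
    · simp [h0]
    · simp [div_eq_inv_mul]

/-- The Segre symbol: the family of the brackets, one for each root of the discriminant. The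
order of the brackets is immaterial, so they are collected in a multiset. -/
def segreSymbol : Multiset (List ℕ) :=
  X.finite_roots.toFinset.val.map X.bracket

end QuadraticComplex

end

/-! Everything rests on the factoriality of the coordinate ring `S = ℂ[x₀, …, x₅] / (G)`. Over `ℂ`
the form `G` becomes `x₀x₁ + x₂x₃ + x₄x₅`, which is linear in `x₀` with coefficient `x₁`. Since `x₁`
stays prime in the quotient, and inverting it leaves a localization of a polynomial ring, Nagata's
criterion applies (`uniqueFactorizationMonoid_quotient`).

Factors of a homogeneous element of the graded domain `S` are homogeneous
(`exists_homogeneous_factors`). So nonzero linear forms are prime in `S`, and `F` is prime unless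
some `F - cG` is a product of two linear forms, that is, has rank at most two.

A bracket of length `6 - k` means a member `aF + bG` of rank `k` with `a ≠ 0`
(`exists_bracket_iff`), and each nonzero multiple of `F` modulo `G` defines the same ideal of `S`.
If all these ranks exceed two, `F` is prime and the complex is integral. A member of rank two is `l
m` with non-associated primes `l`, `m` of `S`: the complex is reduced with the two components `l =
0` and `m = 0`. A member of rank one is `l ^ 2`: the complex is non-reduced, but its radical is the
prime `(l)`. Rank zero would make `F` a multiple of `G`. -/

noncomputable section

/-! ### Nagata's criterion for a polynomial linear in one variable. -/

namespace Polynomial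

variable {A : Type*} [CommRing A]

/-- Modulo `x Y + q`, every polynomial in `Y` becomes constant after multiplication with a power
of `x`. -/
theorem exists_pow_mul_sub_C_mem (x q : A) (f : A[X]) :
    ∃ (n : ℕ) (a : A), C x * X + C q ∣ C (x ^ n) * f - C a := by
  induction f using Polynomial.induction_on' with
  | add f g hf hg =>
    obtain ⟨n, a, ha⟩ := hf
    obtain ⟨m, b, hb⟩ := hg
    refine ⟨n + m, x ^ m * a + x ^ n * b, ?_⟩
    have := dvd_add (ha.mul_left (C (x ^ m))) (hb.mul_left (C (x ^ n)))
    refine this.trans (dvd_of_eq ?_)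
    simp only [map_mul, map_add, pow_add]
    ring
  | monomial k c =>
    refine ⟨k, c * (-q) ^ k, ?_⟩
    have h : C x * X + C q ∣ (C x * X) ^ k - (C (-q)) ^ k := by
      refine (dvd_of_eq ?_).trans (sub_dvd_pow_sub_pow _ _ k)
      simp
    refine (h.mul_left (C c)).trans (dvd_of_eq ?_)
    rw [← C_mul_X_pow_eq_monomial]
    simp only [map_mul, map_pow, mul_pow]
    ring

variable [IsDomain A]

theorem not_linear_dvd_C {x : A} (hx : x ≠ 0) (q : A) {a : A} (h : C x * X + C q ∣ C a) :
    a = 0 := by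
  by_contra ha
  obtain ⟨g, hg⟩ := h
  have hd := natDegree_linear (R := A) (a := x) (b := q) hx
  have hg0 : g ≠ 0 := by
    rintro rfl
    simp [ha] at hg
  have hl : C x * X + C q ≠ 0 := by
    intro h0
    simp [h0] at hd
  have := congrArg natDegree hg
  rw [natDegree_C, natDegree_mul hl hg0, hd] at this
  omega

/-- If `x` is prime and does not divide `q`, then `x Y + q` is prime. -/
theorem prime_linear [UniqueFactorizationMonoid A] {x q : A} (hx : Prime x) (hq : ¬ x ∣ q) :
    Prime (C x * X + C q : A[X]) := by
  rw [← UniqueFactorizationMonoid.irreducible_iff_prime]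
  refine irreducible_C_mul_X_add_C hx.ne_zero ?_
  exact hx.irreducible.isRelPrime_iff_not_dvd.mpr hq

/-- Modulo `x Y + q` one has `q = -Y x`, so the ideal `(x, q)` extended to `A[Y]`, which is still
prime, has image generated by `x` alone. -/
theorem prime_mk_C_linear {x q : A} (h : (Ideal.span {x, q}).IsPrime)
    (hx : x ≠ 0) :
    Prime (Ideal.Quotient.mk (Ideal.span {(C x * X + C q : A[X])}) (C x)) := by
  have hmap : (Ideal.map C (Ideal.span {x, q})).IsPrime := Ideal.isPrime_map_C_of_isPrime
  have hI : Ideal.map (Ideal.Quotient.mk (Ideal.span {(C x * X + C q : A[X])}))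
      (Ideal.map C (Ideal.span {x, q})) = Ideal.span {Ideal.Quotient.mk _ (C x)} := by
    rw [Ideal.map_span, Ideal.map_span, Set.image_pair, Set.image_pair]
    have : Ideal.Quotient.mk (Ideal.span {(C x * X + C q : A[X])}) (C q) =
        - Ideal.Quotient.mk _ X * Ideal.Quotient.mk _ (C x) := by
      rw [← map_neg, ← map_mul, Ideal.Quotient.eq]
      exact Ideal.mem_span_singleton.mpr (dvd_of_eq (by ring))
    rw [this, Ideal.span_pair_eq_span_left_iff_dvd]
    exact dvd_mul_left _ _
  rw [← Ideal.span_singleton_prime, ← hI]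
  · refine Ideal.map_isPrime_of_surjective Ideal.Quotient.mk_surjective ?_
    rw [Ideal.mk_ker, Ideal.span_singleton_le_iff_mem, Ideal.map_span, Set.image_pair]
    refine Ideal.mem_span_pair.mpr ⟨X, 1, by ring⟩
  · rw [Ne, Ideal.Quotient.eq_zero_iff_mem, Ideal.mem_span_singleton]
    exact fun h0 => hx (not_linear_dvd_C hx q h0)

/-- If `x` and `(x, q)` are prime and `x` does not divide `q`, then `A[Y] / (x Y + q)` is
factorial. -/
theorem uniqueFactorizationMonoid_quotient_linear [IsNoetherianRing A]
    [UniqueFactorizationMonoid A] {x q : A} (hx : Prime x) (h : (Ideal.span {x, q}).IsPrime)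
    (hq : ¬ x ∣ q) :
    UniqueFactorizationMonoid (A[X] ⧸ Ideal.span {(C x * X + C q : A[X])}) := by
  set J : Ideal A[X] := Ideal.span {(C x * X + C q : A[X])} with hJ
  have hp := prime_linear hx hq
  have : J.IsPrime := (Ideal.span_singleton_prime hp.ne_zero).mpr hp
  set ξ : A[X] ⧸ J := Ideal.Quotient.mk J (C x) with hξ
  have hξp : Prime ξ := prime_mk_C_linear h hx.ne_zero
  have hinj : ∀ a : A, Ideal.Quotient.mk J (C a) = 0 → a = 0 := fun a ha => by
    rw [Ideal.Quotient.eq_zero_iff_mem, Ideal.mem_span_singleton] at ha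
    exact not_linear_dvd_C hx.ne_zero q ha
  -- Nagata: it suffices to invert the prime `x`. Then `Y = -q / x`, so the result is just `A` with
  -- `x` inverted.
  rw [UniqueFactorizationMonoid.iff_localizationAway_of_prime hξp]
  let φ : A →+* Localization.Away ξ :=
    (algebraMap (A[X] ⧸ J) (Localization.Away ξ)).comp ((Ideal.Quotient.mk J).comp C)
  let _ : Algebra A (Localization.Away ξ) := φ.toAlgebra
  have hφ : ∀ a, algebraMap A (Localization.Away ξ) a =
    algebraMap (A[X] ⧸ J) (Localization.Away ξ) (Ideal.Quotient.mk J (C a)) := fun _ => rfl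
  have hloc : IsLocalization.Away x (Localization.Away ξ) := by
    refine IsLocalization.Away.mk x ?_ ?_ ?_
    · rw [hφ]
      exact IsLocalization.Away.algebraMap_isUnit ξ
    · intro z
      obtain ⟨n, r, hr⟩ := IsLocalization.Away.surj ξ z
      obtain ⟨f, rfl⟩ := Ideal.Quotient.mk_surjective r
      obtain ⟨m, a, ha⟩ := exists_pow_mul_sub_C_mem x q f
      refine ⟨n + m, a, ?_⟩
      have ha' : Ideal.Quotient.mk J (C a) = ξ ^ m * Ideal.Quotient.mk J f := by
        rw [hξ, ← map_pow, ← map_mul, eq_comm, Ideal.Quotient.eq, ← C_pow]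
        exact Ideal.mem_span_singleton.mpr ha
      rw [hφ, hφ, ha', map_mul, ← hr, map_pow, ← hξ]
      ring
    · intro a b hab
      rw [hφ, hφ] at hab
      have h1 := IsLocalization.injective (Localization.Away ξ)
        (powers_le_nonZeroDivisors_of_noZeroDivisors hξp.ne_zero) hab
      refine ⟨0, ?_⟩
      rw [← sub_eq_zero, ← map_sub, ← map_sub] at h1
      rw [sub_eq_zero.mp (hinj _ h1)]
  exact UniqueFactorizationMonoid.of_isLocalization (Submonoid.powers x) (Localization.Away ξ)

end Polynomial

/-! ### Factoriality of the split quadric. -/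

namespace QuadricPencil

open MvPolynomial

/-- The polynomial is linear in `X 2`, with leading coefficient `X 1` coprime to `X 3 * X 4`. -/
theorem irreducible_X_mul_X_add_X_mul_X :
    Irreducible (X 1 * X 2 + X 3 * X 4 : MvPolynomial (Fin 5) ℂ) := by
  refine irreducible_mul_X_add (X 1) (X 3 * X 4) 2 (X_ne_zero 1) ?_ ?_ ?_
  · simp
  · intro h
    have := vars_mul _ _ h
    simp at this
  · refine (X_prime (R := ℂ) (i := (1 : Fin 5))).irreducible.isRelPrime_iff_not_dvd.mpr ?_
    intro h
    rcases X_prime.dvd_or_dvd h with h | h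
    · simpa using X_dvd_X.mp h
    · simpa using X_dvd_X.mp h

/-- The quadric does not involve `X 0`, so the ideal is the preimage of the prime ideal `(q)` under
the substitution `X 0 ↦ 0`. -/
theorem isPrime_span_X_quadric :
    (Ideal.span {(X 0 : MvPolynomial (Fin 5) ℂ), X 1 * X 2 + X 3 * X 4}).IsPrime := by
  set q : MvPolynomial (Fin 5) ℂ := X 1 * X 2 + X 3 * X 4 with hq
  let π : MvPolynomial (Fin 5) ℂ →ₐ[ℂ] MvPolynomial (Fin 5) ℂ := aeval (Function.update X 0 0)
  have hπ : ∀ i ≠ 0, π (X i) = X i := fun i hi => by simp [π, hi]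
  have hπ0 : π (X 0) = 0 := by simp [π]
  have hπq : π q = q := by simp [hq, hπ]
  have hsub : ∀ f, X 0 ∣ f - π f := by
    intro f
    induction f using MvPolynomial.induction_on with
    | C a => simp [π]
    | add f g hf hg =>
      rw [map_add, add_sub_add_comm]
      exact dvd_add hf hg
    | mul_X f i hf =>
      rw [map_mul]
      by_cases hi : i = 0
      · subst hi
        rw [hπ0, mul_zero, sub_zero]
        exact dvd_mul_left _ _
      · rw [hπ i hi, ← sub_mul]
        exact hf.mul_right _
  have hqp : Prime q := by
    rw [← UniqueFactorizationMonoid.irreducible_iff_prime]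
    exact irreducible_X_mul_X_add_X_mul_X
  have hprime : (Ideal.span {q}).IsPrime := (Ideal.span_singleton_prime hqp.ne_zero).mpr hqp
  have : Ideal.span {X 0, q} = (Ideal.span {q}).comap π := by
    refine le_antisymm ?_ ?_
    · rw [Ideal.span_le]
      rintro _ (rfl | rfl)
      · simp [hπ0]
      · simp [hπq]
    · intro f hf
      obtain ⟨g, hg⟩ := Ideal.mem_span_singleton.mp (Ideal.mem_comap.mp hf)
      obtain ⟨h, hh⟩ := hsub f
      refine Ideal.mem_span_pair.mpr ⟨h, g, ?_⟩
      have hg' : π f = q * g := hg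
      linear_combination -hh - hg'
  rw [this]
  exact Ideal.comap_isPrime π _

/-- The coordinate ring of the split quadric in `ℙ⁵` is factorial. -/
theorem uniqueFactorizationMonoid_split :
    UniqueFactorizationMonoid (MvPolynomial (Fin 6) ℂ ⧸
      Ideal.span {(X 0 * X 1 + X 2 * X 3 + X 4 * X 5 : MvPolynomial (Fin 6) ℂ)}) := by
  have hndvd : ¬ (X 0 : MvPolynomial (Fin 5) ℂ) ∣ X 1 * X 2 + X 3 * X 4 := by
    intro h
    -- At this point `X 0` vanishes and the quadric takes the value one.
    have h1 := (aeval (R := ℂ) (![0, 1, 1, 0, 0] : Fin 5 → ℂ)).toRingHom.map_dvd h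
    simp at h1
  -- Under `finSuccEquiv` the old `X 0` is the variable `Y`, and the old `X 1` is the coefficient `x
  -- = X 0`.
  have key := Polynomial.uniqueFactorizationMonoid_quotient_linear
    (X_prime (R := ℂ) (i := (0 : Fin 5))) isPrime_span_X_quadric hndvd
  refine (Ideal.quotientEquiv _ _ (finSuccEquiv ℂ 5).toRingEquiv ?_).symm.toMulEquiv.uniqueFactorizationMonoid key
  rw [Ideal.map_span, Set.image_singleton]
  congr 2
  have h1 : ∀ i : Fin 5, finSuccEquiv ℂ 5 (X i.succ) = Polynomial.C (X i) := fun i =>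
    finSuccEquiv_X_succ
  have e0 := h1 0
  have e1 := h1 1
  have e2 := h1 2
  have e3 := h1 3
  have e4 := h1 4
  simp only [Fin.reduceSucc] at e0 e1 e2 e3 e4
  simp [e0, e1, e2, e3, e4, finSuccEquiv_X_zero]
  ring

end QuadricPencil
end

noncomputable section
namespace QuadricPencil

open MvPolynomial

/-! ### Quadratic forms and linear changes of coordinates -/

/-- The linear form `∑ᵢ lᵢ xᵢ`. -/
def linForm (l : Fin 6 → ℂ) : MvPolynomial (Fin 6) ℂ :=
  ∑ i, C (l i) * X i

theorem linForm_isHomogeneous (l : Fin 6 → ℂ) : (linForm l).IsHomogeneous 1 :=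
  IsHomogeneous.sum _ _ _ fun _ _ => (isHomogeneous_C _ _).mul (isHomogeneous_X _ _)

theorem eval_linForm (l v : Fin 6 → ℂ) : eval v (linForm l) = l ⬝ᵥ v := by
  simp [linForm, dotProduct]

theorem linForm_smul (c : ℂ) (l : Fin 6 → ℂ) : linForm (c • l) = C c * linForm l := by
  simp [linForm, Finset.mul_sum, mul_assoc]

theorem linForm_single (i : Fin 6) : linForm (Pi.single i 1) = X i := by
  simp [linForm, Pi.single_apply]

theorem linForm_injective : Function.Injective linForm := by
  intro l m h
  ext i
  simpa [eval_linForm] using congrArg (eval (Pi.single i 1)) h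

theorem linForm_zero : linForm 0 = 0 := by simp [linForm]

theorem exists_linForm {p : MvPolynomial (Fin 6) ℂ} (hp : p.IsHomogeneous 1) :
    ∃ l, p = linForm l := by
  refine ⟨fun i => coeff (Finsupp.single i 1) p, ?_⟩
  ext d
  by_cases hd : d.degree = 1
  · obtain ⟨i, rfl⟩ := (Finsupp.sum_eq_one_iff d).mp hd
    simp [linForm, coeff_sum, coeff_C_mul, coeff_X, Finsupp.single_left_inj]
  · rw [hp.coeff_eq_zero hd, (linForm_isHomogeneous _).coeff_eq_zero hd]

theorem eval_quadricForm (M : Matrix (Fin 6) (Fin 6) ℂ) (v : Fin 6 → ℂ) :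
    eval v (quadricForm M) = M.toQuadraticForm' v := by
  simp only [quadricForm, map_sum, map_mul, eval_C, eval_X, Matrix.toQuadraticForm',
    LinearMap.BilinMap.toQuadraticMap_apply, Matrix.toLinearMap₂'_apply]
  refine Finset.sum_congr rfl fun i _ => Finset.sum_congr rfl fun j _ => ?_
  simp
  ring

theorem quadricForm_add (M N : Matrix (Fin 6) (Fin 6) ℂ) :
    quadricForm (M + N) = quadricForm M + quadricForm N := by
  simp [quadricForm, add_mul, Finset.sum_add_distrib]

theorem quadricForm_smul (c : ℂ) (M : Matrix (Fin 6) (Fin 6) ℂ) :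
    quadricForm (c • M) = C c * quadricForm M := by
  simp [quadricForm, Finset.mul_sum, mul_assoc]

/-- Polarization recovers a symmetric matrix from its quadratic form; this gives both uniqueness of
the matrix and nondegeneracy of the form. -/
theorem associated_toQuadraticForm' {M : Matrix (Fin 6) (Fin 6) ℂ} (hM : M.IsSymm) :
    QuadraticMap.associated M.toQuadraticForm' = Matrix.toLinearMap₂' ℂ M := by
  refine QuadraticMap.associated_left_inverse _ fun x y => ?_
  simp only [Matrix.toLinearMap₂'_apply']
  rw [Matrix.dotProduct_mulVec, ← Matrix.mulVec_transpose, hM.eq, dotProduct_comm]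

/-- A symmetric matrix is determined by its quadratic form. -/
theorem quadricForm_inj {M N : Matrix (Fin 6) (Fin 6) ℂ} (hM : M.IsSymm) (hN : N.IsSymm)
    (h : quadricForm M = quadricForm N) : M = N := by
  have h1 : M.toQuadraticForm' = N.toQuadraticForm' := by
    ext v
    rw [← eval_quadricForm, h, eval_quadricForm]
  apply (Matrix.toLinearMap₂' ℂ (S₁ := ℂ) (S₂ := ℂ) (N₂ := ℂ)
    (n := Fin 6) (m := Fin 6)).injective
  rw [← associated_toQuadraticForm' hM, ← associated_toQuadraticForm' hN, h1]

/-- The substitution of a linear map into polynomials. -/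
def linSubst (e : (Fin 6 → ℂ) →ₗ[ℂ] (Fin 6 → ℂ)) :
    MvPolynomial (Fin 6) ℂ →ₐ[ℂ] MvPolynomial (Fin 6) ℂ :=
  aeval fun i => linForm (LinearMap.toMatrix' e i)

theorem eval_linSubst (e : (Fin 6 → ℂ) →ₗ[ℂ] (Fin 6 → ℂ)) (v : Fin 6 → ℂ)
    (p : MvPolynomial (Fin 6) ℂ) : eval v (linSubst e p) = eval (e v) p := by
  induction p using MvPolynomial.induction_on with
  | C a => simp [linSubst]
  | add p q hp hq => simp [hp, hq]
  | mul_X p i hp =>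
    rw [map_mul, map_mul, hp, map_mul, eval_X]
    congr 1
    rw [linSubst, aeval_X, eval_linForm]
    conv_rhs => rw [← Matrix.toLin'_toMatrix' e]
    rw [Matrix.toLin'_apply, Matrix.mulVec]

/-- The automorphism of the polynomial ring given by a linear change of coordinates. -/
def linChange (e : (Fin 6 → ℂ) ≃ₗ[ℂ] (Fin 6 → ℂ)) :
    MvPolynomial (Fin 6) ℂ ≃ₐ[ℂ] MvPolynomial (Fin 6) ℂ :=
  AlgEquiv.ofAlgHom (linSubst e) (linSubst e.symm)
    (AlgHom.ext fun p => MvPolynomial.funext fun v => by simp [eval_linSubst])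
    (AlgHom.ext fun p => MvPolynomial.funext fun v => by simp [eval_linSubst])

theorem eval_linChange (e : (Fin 6 → ℂ) ≃ₗ[ℂ] (Fin 6 → ℂ)) (v : Fin 6 → ℂ)
    (p : MvPolynomial (Fin 6) ℂ) : eval v (linChange e p) = eval (e v) p :=
  eval_linSubst _ _ _

theorem separatingLeft_associated {M : Matrix (Fin 6) (Fin 6) ℂ} (hM : M.IsSymm)
    (hd : M.det ≠ 0) : (QuadraticMap.associated M.toQuadraticForm').SeparatingLeft := by
  rw [associated_toQuadraticForm' hM]
  exact (Matrix.nondegenerate_of_det_ne_zero hd).toLinearMap₂'.1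

/-- The matrix of the split quadratic form `x₀ x₁ + x₂ x₃ + x₄ x₅`. -/
def splitMatrix : Matrix (Fin 6) (Fin 6) ℂ :=
  !![0, 2⁻¹, 0, 0, 0, 0; 2⁻¹, 0, 0, 0, 0, 0; 0, 0, 0, 2⁻¹, 0, 0; 0, 0, 2⁻¹, 0, 0, 0;
    0, 0, 0, 0, 0, 2⁻¹; 0, 0, 0, 0, 2⁻¹, 0]

theorem splitMatrix_isSymm : splitMatrix.IsSymm := by
  ext i j
  fin_cases i <;> fin_cases j <;> rfl

theorem splitMatrix_det : splitMatrix.det ≠ 0 := by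
  -- The matrix swaps coordinates in pairs up to the factor `2⁻¹`, so its square is a quarter of the
  -- identity.
  have h : splitMatrix * ((4 : ℂ) • splitMatrix) = 1 := by
    ext i j
    fin_cases i <;> fin_cases j <;>
      simp [splitMatrix, Matrix.mul_apply, Fin.sum_univ_succ] <;> norm_num
  intro h0
  have := congrArg Matrix.det h
  simp [h0] at this

theorem quadricForm_splitMatrix :
    quadricForm splitMatrix = X 0 * X 1 + X 2 * X 3 + X 4 * X 5 := by
  refine MvPolynomial.funext fun v => ?_
  simp [quadricForm, splitMatrix, Fin.sum_univ_succ]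
  ring

/-- The coordinate ring of a smooth quadric in `ℙ⁵` is factorial. -/
theorem uniqueFactorizationMonoid_quotient {G : Matrix (Fin 6) (Fin 6) ℂ} (hG : G.IsSymm)
    (hd : G.det ≠ 0) :
    UniqueFactorizationMonoid (MvPolynomial (Fin 6) ℂ ⧸ Ideal.span {quadricForm G}) := by
  -- Over `ℂ` all nondegenerate forms of the same dimension are equivalent, which reduces the claim
  -- to the split quadric.
  obtain ⟨e⟩ := QuadraticForm.equivalent_of_isAlgClosed _ _ (separatingLeft_associated hG hd)
    (separatingLeft_associated splitMatrix_isSymm splitMatrix_det)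
  have he : linChange e.toLinearEquiv (quadricForm splitMatrix) = quadricForm G := by
    refine MvPolynomial.funext fun v => ?_
    rw [eval_linChange, eval_quadricForm, eval_quadricForm]
    exact e.map_app v
  refine (Ideal.quotientEquiv _ _ (linChange e.toLinearEquiv).toRingEquiv
    ?_).toMulEquiv.uniqueFactorizationMonoid uniqueFactorizationMonoid_split
  rw [Ideal.map_span, Set.image_singleton, ← quadricForm_splitMatrix]
  exact congrArg (fun x => Ideal.span {x}) he.symm

end QuadricPencil
end

noncomputable section
namespace QuadricPencil

open MvPolynomial

/-! ### The rank of a quadratic form -/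

theorem toQuadraticForm'_apply (M : Matrix (Fin 6) (Fin 6) ℂ) (v : Fin 6 → ℂ) :
    M.toQuadraticForm' v = v ⬝ᵥ M.mulVec v := by
  simp [Matrix.toQuadraticForm', Matrix.toLinearMap₂'_apply']

/-- Over `ℂ`, symmetric matrices can be diagonalized by congruence. -/
theorem exists_diagonalization {M : Matrix (Fin 6) (Fin 6) ℂ} (hM : M.IsSymm) :
    ∃ (w : Fin 6 → ℂ) (P : Matrix (Fin 6) (Fin 6) ℂ), IsUnit P.det ∧
      M = P.transpose * Matrix.diagonal w * P ∧
      quadricForm M = ∑ i, C (w i) * linForm (P i) ^ 2 := by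
  have h := M.toQuadraticForm'.equivalent_weightedSumSquares
  rw [Module.finrank_fin_fun] at h
  obtain ⟨w, ⟨e⟩⟩ := h
  set P := LinearMap.toMatrix' (e.toLinearEquiv : (Fin 6 → ℂ) →ₗ[ℂ] (Fin 6 → ℂ)) with hP
  have hPv : ∀ v, P.mulVec v = e v := fun v => by
    rw [← Matrix.toLin'_apply, hP, Matrix.toLin'_toMatrix']
    rfl
  have hQ : quadricForm M = ∑ i, C (w i) * linForm (P i) ^ 2 := by
    refine MvPolynomial.funext fun v => ?_
    rw [eval_quadricForm, ← e.map_app v, QuadraticMap.weightedSumSquares_apply, map_sum]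
    refine Finset.sum_congr rfl fun i _ => ?_
    rw [map_mul, map_pow, eval_C, eval_linForm, ← hPv, Matrix.mulVec, smul_eq_mul, pow_two]
  refine ⟨w, P, ?_, ?_, hQ⟩
  · rw [hP, LinearMap.det_toMatrix']
    exact e.toLinearEquiv.isUnit_det'
  · refine quadricForm_inj hM ?_ ?_
    · rw [Matrix.IsSymm, Matrix.transpose_mul, Matrix.transpose_mul, Matrix.transpose_transpose,
        Matrix.diagonal_transpose, Matrix.mul_assoc]
    · refine MvPolynomial.funext fun v => ?_
      rw [hQ, map_sum, eval_quadricForm, toQuadraticForm'_apply, ← Matrix.mulVec_mulVec,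
        ← Matrix.mulVec_mulVec, Matrix.dotProduct_mulVec, Matrix.vecMul_transpose, dotProduct]
      refine Finset.sum_congr rfl fun i _ => ?_
      rw [map_mul, map_pow, eval_C, eval_linForm, Matrix.mulVec_diagonal, Matrix.mulVec]
      ring

/-- Congruence by an invertible matrix preserves the rank, and the rank of a diagonal matrix counts
its nonzero entries. -/
theorem exists_diagonalization_rank {M : Matrix (Fin 6) (Fin 6) ℂ} (hM : M.IsSymm) :
    ∃ (w : Fin 6 → ℂ) (P : Matrix (Fin 6) (Fin 6) ℂ),
      (Finset.univ.filter fun i => w i ≠ 0).card = M.rank ∧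
      quadricForm M = ∑ i, C (w i) * linForm (P i) ^ 2 := by
  classical
  obtain ⟨w, P, hP, hMP, hQ⟩ := exists_diagonalization hM
  refine ⟨w, P, ?_, hQ⟩
  rw [hMP, Matrix.rank_mul_eq_left_of_isUnit_det _ _ hP,
    Matrix.rank_mul_eq_right_of_isUnit_det _ _ (by rwa [Matrix.det_transpose]),
    Matrix.rank_diagonal, Fintype.card_subtype]

theorem C_mul_linForm_sq (w : ℂ) (l : Fin 6 → ℂ) :
    ∃ m : Fin 6 → ℂ, C w * linForm l ^ 2 = linForm m ^ 2 := by
  obtain ⟨s, hs⟩ := IsAlgClosed.exists_pow_nat_eq w (n := 2) (by norm_num)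
  exact ⟨s • l, by rw [linForm_smul, mul_pow, ← map_pow, hs]⟩

theorem linForm_add (l m : Fin 6 → ℂ) : linForm (l + m) = linForm l + linForm m := by
  simp [linForm, add_mul, Finset.sum_add_distrib]

/-- The symmetric matrix of a product of two linear forms. -/
theorem quadricForm_symm_vecMulVec (l m : Fin 6 → ℂ) :
    quadricForm ((2⁻¹ : ℂ) • (Matrix.vecMulVec l m + Matrix.vecMulVec m l)) =
      linForm l * linForm m := by
  refine MvPolynomial.funext fun v => ?_
  rw [eval_quadricForm, toQuadraticForm'_apply, Matrix.smul_mulVec, Matrix.add_mulVec,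
    Matrix.vecMulVec_mulVec, Matrix.vecMulVec_mulVec, map_mul, eval_linForm, eval_linForm,
    dotProduct_smul, dotProduct_add]
  simp [dotProduct_comm v]
  ring

theorem symm_vecMulVec_isSymm (l m : Fin 6 → ℂ) :
    ((2⁻¹ : ℂ) • (Matrix.vecMulVec l m + Matrix.vecMulVec m l)).IsSymm := by
  rw [Matrix.IsSymm, Matrix.transpose_smul, Matrix.transpose_add, Matrix.transpose_vecMulVec,
    Matrix.transpose_vecMulVec, add_comm]

/-- A quadratic form has rank at most one iff it is the square of a linear form. -/
theorem rank_le_one_iff {M : Matrix (Fin 6) (Fin 6) ℂ} (hM : M.IsSymm) :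
    M.rank ≤ 1 ↔ ∃ l, quadricForm M = linForm l ^ 2 := by
  constructor
  · intro h
    obtain ⟨w, P, hw, hQ⟩ := exists_diagonalization_rank hM
    rw [← hw] at h
    obtain ⟨i, hi⟩ := Finset.card_le_one_iff_subset_singleton.mp h
    have h0 : ∀ k ≠ i, w k = 0 := fun k hk => by
      by_contra hne
      exact hk (Finset.mem_singleton.mp (hi (by simpa using hne)))
    obtain ⟨m, hm⟩ := C_mul_linForm_sq (w i) (P i)
    refine ⟨m, ?_⟩
    rw [hQ, ← hm]
    exact Finset.sum_eq_single_of_mem i (Finset.mem_univ _) fun k _ hk => by simp [h0 k hk]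
  · rintro ⟨l, hl⟩
    have : M = (2⁻¹ : ℂ) • (Matrix.vecMulVec l l + Matrix.vecMulVec l l) :=
      quadricForm_inj hM (symm_vecMulVec_isSymm l l)
        (by rw [hl, quadricForm_symm_vecMulVec, pow_two])
    rw [this, ← two_smul ℂ, smul_smul, inv_mul_cancel₀ two_ne_zero, one_smul]
    exact Matrix.rank_vecMulVec_le _ _

/-- A quadratic form has rank at most two iff it is a product of two linear forms. -/
theorem rank_le_two_iff {M : Matrix (Fin 6) (Fin 6) ℂ} (hM : M.IsSymm) :
    M.rank ≤ 2 ↔ ∃ l m, quadricForm M = linForm l * linForm m := by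
  constructor
  · intro h
    obtain ⟨w, P, hw, hQ⟩ := exists_diagonalization_rank hM
    rw [← hw] at h
    -- Enlarging the support to exactly two indices treats all ranks up to two at once.
    obtain ⟨t, ht, htc⟩ := Finset.exists_superset_card_eq h (by simp)
    obtain ⟨i, j, hij, rfl⟩ := Finset.card_eq_two.mp htc
    have h0 : ∀ k ∉ ({i, j} : Finset (Fin 6)), w k = 0 := fun k hk => by
      by_contra hne
      exact hk (ht (by simpa using hne))
    obtain ⟨l, hl⟩ := C_mul_linForm_sq (w i) (P i)
    obtain ⟨m, hm⟩ := C_mul_linForm_sq (w j) (P j)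
    -- The factorization `l² + m² = (l + i m)(l - i m)`.
    refine ⟨l + Complex.I • m, l + (-Complex.I) • m, ?_⟩
    rw [hQ, ← Finset.sum_subset (Finset.subset_univ ({i, j} : Finset (Fin 6)))
      fun k _ hk => by simp [h0 k hk], Finset.sum_pair hij, hl, hm, linForm_add, linForm_add,
      linForm_smul, linForm_smul, map_neg]
    have : (C Complex.I : MvPolynomial (Fin 6) ℂ) * C Complex.I = -1 := by
      rw [← map_mul, Complex.I_mul_I, map_neg, map_one]
    linear_combination linForm m ^ 2 * this
  · rintro ⟨l, m, hl⟩
    have : M = (2⁻¹ : ℂ) • (Matrix.vecMulVec l m + Matrix.vecMulVec m l) :=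
      quadricForm_inj hM (symm_vecMulVec_isSymm l m) (by rw [hl, quadricForm_symm_vecMulVec])
    -- The matrix factors through `ℂ²`, which bounds its rank by two.
    have h2 : M = (Matrix.of ![(2⁻¹ : ℂ) • l, (2⁻¹ : ℂ) • m]).transpose * Matrix.of ![m, l] := by
      rw [this]
      ext i j
      simp [Matrix.mul_apply, Matrix.vecMulVec_apply, Fin.sum_univ_two]
      ring
    rw [h2]
    exact (Matrix.rank_mul_le_left _ _).trans (Matrix.rank_le_width _)

/-! ### Minors and the rank -/

/-- Some of the rows form a basis of the row space; any `k` of these, listed in increasing order,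
will do. -/
theorem exists_linearIndependent_rows {k n m : ℕ} (M : Matrix (Fin n) (Fin m) ℂ)
    (h : k ≤ M.rank) :
    ∃ r : Fin k ↪o Fin n, LinearIndependent ℂ (M.submatrix r id).row := by
  classical
  obtain ⟨κ, a, ha, hspan, hli⟩ := exists_linearIndependent' ℂ M.row
  have : Finite κ := Finite.of_injective a ha
  have := Fintype.ofFinite κ
  have hc : Fintype.card κ = M.rank := by
    rw [Matrix.rank_eq_finrank_span_row, ← hspan, finrank_span_eq_card hli]
  have hs : k ≤ (Finset.univ.image a).card := by
    rw [Finset.card_image_of_injective _ ha, Finset.card_univ, hc]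
    exact h
  obtain ⟨s, hs1, hs2⟩ := Finset.exists_subset_card_eq hs
  refine ⟨s.orderEmbOfFin hs2, ?_⟩
  have hmem : ∀ i, ∃ c, a c = s.orderEmbOfFin hs2 i := fun i => by
    have := hs1 (s.orderEmbOfFin_mem hs2 i)
    simpa using this
  choose c hc' using hmem
  have hcinj : Function.Injective c := fun i j hij => by
    apply (s.orderEmbOfFin hs2).injective
    rw [← hc', ← hc', hij]
  have := hli.comp c hcinj
  have hrow : (M.submatrix (s.orderEmbOfFin hs2) id).row = (M.row ∘ a) ∘ c := by
    funext i
    simp only [Function.comp_apply, hc']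
    rfl
  rwa [hrow]

/-- A matrix has a nonzero minor of order `k` iff its rank is at least `k`. -/
theorem exists_minor_ne_zero_iff {k n m : ℕ} (M : Matrix (Fin n) (Fin m) ℂ) :
    (∃ (r : Fin k ↪o Fin n) (c : Fin k ↪o Fin m), (M.submatrix r c).det ≠ 0) ↔ k ≤ M.rank := by
  constructor
  · rintro ⟨r, c, h⟩
    have h1 := Matrix.rank_of_det_ne_zero h
    rw [Fintype.card_fin] at h1
    exact h1 ▸ M.rank_submatrix_le r c
  · intro h
    obtain ⟨r, hr⟩ := exists_linearIndependent_rows M h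
    have h1 : (M.submatrix r id).transpose.rank = k := by
      rw [Matrix.rank_transpose, hr.rank_matrix, Fintype.card_fin]
    obtain ⟨c, hc⟩ := exists_linearIndependent_rows (k := k) _ h1.ge
    refine ⟨r, c, ?_⟩
    have h2 : (M.submatrix r c).transpose =
      (M.submatrix r id).transpose.submatrix c id := rfl
    rw [← Matrix.det_transpose, h2]
    have := Matrix.linearIndependent_rows_iff_isUnit.mp hc
    exact ((Matrix.isUnit_iff_isUnit_det _).mp this).ne_zero

end QuadricPencil

/-! ### Bracket lengths as coranks of the members of the pencil. -/

namespace QuadraticComplex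

open MvPolynomial QuadricPencil
open scoped LinearAlgebra.Projectivization

variable (X : QuadraticComplex)

/-- The member `a F + b G` of the pencil. -/
def member (a b : ℂ) : Matrix (Fin 6) (Fin 6) ℂ := a • X.F + b • X.G

theorem member_isSymm (a b : ℂ) : (X.member a b).IsSymm :=
  (X.F_symm.smul a).add (X.G_symm.smul b)

theorem member_smul (c a b : ℂ) : X.member (c * a) (c * b) = c • X.member a b := by
  rw [member, member, smul_add, smul_smul, smul_smul]

theorem eval_minor (v : Fin 2 → ℂ) {k : ℕ} (r c : Fin k ↪o Fin 6) :
    eval v (X.minor r c) = ((X.member (v 0) (v 1)).submatrix r c).det := by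
  rw [minor, RingHom.map_det]
  refine congrArg Matrix.det ?_
  ext i j
  simp [pencil, member]

theorem eval_discriminant (v : Fin 2 → ℂ) :
    eval v X.discriminant = (X.member (v 0) (v 1)).det := by
  rw [discriminant, RingHom.map_det]
  refine congrArg Matrix.det ?_
  ext i j
  simp [pencil, member]

/-- Some minor of order `6 - k` is nonzero iff `6 - k` is at most the rank, so the set defining the
length is a ray. For `k > 6` the truncated order is zero and the empty minor is one. -/
theorem bracketLength_eq (p : ℙ ℂ (Fin 2 → ℂ)) :
    X.bracketLength p = 6 - (X.member (p.rep 0) (p.rep 1)).rank := by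
  have h6 : (X.member (p.rep 0) (p.rep 1)).rank ≤ 6 := Matrix.rank_le_width _
  have : {k | ∃ r c : Fin (6 - k) ↪o Fin 6, eval p.rep (X.minor r c) ≠ 0} =
      Set.Ici (6 - (X.member (p.rep 0) (p.rep 1)).rank) := by
    ext k
    simp only [eval_minor, Set.mem_ofPred_eq, exists_minor_ne_zero_iff, Set.mem_Ici]
    omega
  rw [bracketLength, this, csInf_Ici]

/-- The Segre symbol contains a bracket of length `6 - k` iff the pencil has a member of
rank `k`. -/
theorem exists_bracket_iff {k : ℕ} (hk : k < 6) :
    (∃ b ∈ X.segreSymbol, b.length = 6 - k) ↔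
      ∃ a b : ℂ, a ≠ 0 ∧ (X.member a b).rank = k := by
  have hlt : ∀ a b : ℂ, (X.member a b).rank = k → (X.member a b).det = 0 := fun a b h => by
    by_contra h0
    have := Matrix.rank_of_det_ne_zero h0
    rw [Fintype.card_fin] at this
    omega
  simp only [segreSymbol, Multiset.mem_map, Finset.mem_val, Set.Finite.mem_toFinset,
    exists_exists_and_eq_and, bracket, List.length_map, List.length_range, bracketLength_eq]
  constructor
  · rintro ⟨p, hp, h⟩
    have h6 : (X.member (p.rep 0) (p.rep 1)).rank ≤ 6 := Matrix.rank_le_width _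
    refine ⟨p.rep 0, p.rep 1, fun h0 => ?_, by omega⟩
    have hd : (X.member (p.rep 0) (p.rep 1)).det = 0 := hlt _ _ (by omega)
    -- With first coordinate zero the member would be a multiple of the nondegenerate `G`.
    rw [member, h0, zero_smul, zero_add, Matrix.det_smul] at hd
    rcases mul_eq_zero.mp hd with h1 | h1
    · apply p.rep_nonzero
      ext i
      fin_cases i
      · exact h0
      · exact eq_zero_of_pow_eq_zero h1
    · exact X.G_smooth h1
  · rintro ⟨a, b, ha, hr⟩
    have hne : (![a, b] : Fin 2 → ℂ) ≠ 0 := fun h => ha (by simpa using congrFun h 0)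
    set p := Projectivization.mk ℂ ![a, b] hne with hp
    -- The chosen representative differs from `(a, b)` by a unit, which does not affect the rank.
    obtain ⟨c, hc⟩ := Projectivization.exists_smul_eq_mk_rep ℂ ![a, b] hne
    have h0 : p.rep 0 = c * a := by rw [hp, ← hc]; simp [Units.smul_def]
    have h1 : p.rep 1 = c * b := by rw [hp, ← hc]; simp [Units.smul_def]
    have hrk : (X.member (p.rep 0) (p.rep 1)).rank = k := by
      rw [h0, h1, member_smul, Matrix.rank_smul_of_mem_nonZeroDivisors, hr]
      exact mem_nonZeroDivisors_of_ne_zero c.ne_zero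
    refine ⟨p, ?_, by omega⟩
    rw [roots, Set.mem_ofPred_eq, eval_discriminant]
    exact hlt _ _ hrk

end QuadraticComplex
end

noncomputable section
namespace QuadricPencil

open MvPolynomial

/-! ### Factorizations of homogeneous elements -/

/-- The homomorphism `xᵢ ↦ xᵢ T` to the polynomial ring over a quotient, which separates the
homogeneous components. -/
def gradingHom {n : ℕ} (J : Ideal (MvPolynomial (Fin n) ℂ)) :
    MvPolynomial (Fin n) ℂ →ₐ[ℂ] Polynomial (MvPolynomial (Fin n) ℂ ⧸ J) :=
  aeval fun i => Polynomial.C (Ideal.Quotient.mk J (X i)) * Polynomial.X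

theorem gradingHom_monomial {n : ℕ} (J : Ideal (MvPolynomial (Fin n) ℂ)) (d : Fin n →₀ ℕ)
    (c : ℂ) : gradingHom J (monomial d c) =
      Polynomial.C (Ideal.Quotient.mk J (monomial d c)) * Polynomial.X ^ d.degree := by
  have h : ∀ i : Fin n, (Polynomial.C (Ideal.Quotient.mk J (X i)) * Polynomial.X) ^ d i =
      Polynomial.C (Ideal.Quotient.mk J (X i ^ d i)) * Polynomial.X ^ d i := fun i => by
    rw [map_pow, map_pow, (Polynomial.commute_X _).symm.mul_pow]
  rw [gradingHom, aeval_monomial, monomial_eq, Finsupp.prod, Finsupp.prod,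
    Finset.prod_congr rfl fun i _ => h i, Finset.prod_mul_distrib, Finset.prod_pow_eq_pow_sum,
    ← Finsupp.degree_apply, ← mul_assoc, map_mul, map_mul, map_prod, map_prod]
  rfl

theorem gradingHom_of_isHomogeneous {n : ℕ} (J : Ideal (MvPolynomial (Fin n) ℂ)) {k : ℕ}
    {p : MvPolynomial (Fin n) ℂ} (hp : p.IsHomogeneous k) :
    gradingHom J p = Polynomial.C (Ideal.Quotient.mk J p) * Polynomial.X ^ k := by
  conv_lhs => rw [p.as_sum]
  conv_rhs => rw [p.as_sum]
  rw [map_sum, map_sum, map_sum, Finset.sum_mul]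
  refine Finset.sum_congr rfl fun d hd => ?_
  rw [gradingHom_monomial]
  have : d.degree = k := by
    by_contra h
    exact (mem_support_iff.mp hd) (hp.coeff_eq_zero h)
  rw [this]

/-- Hence `gradingHom` kills a homogeneous ideal `J`, and homogeneity modulo `J` can be read off
from the image being a monomial in `T`. -/
theorem coeff_gradingHom {n : ℕ} (J : Ideal (MvPolynomial (Fin n) ℂ))
    (p : MvPolynomial (Fin n) ℂ) (d : ℕ) :
    (gradingHom J p).coeff d = Ideal.Quotient.mk J (homogeneousComponent d p) := by
  conv_lhs => rw [← sum_homogeneousComponent p]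
  rw [map_sum, Polynomial.finsetSum_coeff]
  simp only [gradingHom_of_isHomogeneous J (homogeneousComponent_isHomogeneous _ p),
    Polynomial.coeff_C_mul_X_pow]
  rw [Finset.sum_ite_eq]
  split_ifs with h
  · rfl
  · rw [Finset.mem_range, not_lt, Nat.succ_le_iff] at h
    rw [homogeneousComponent_eq_zero d p h, map_zero]

/-- In the quotient by a homogeneous prime ideal, the factors of a nonzero homogeneous element are
homogeneous. -/
theorem exists_homogeneous_factors {n : ℕ} {J : Ideal (MvPolynomial (Fin n) ℂ)} [J.IsPrime]
    (hJ : ∀ p ∈ J, ∀ d, homogeneousComponent d p ∈ J) {k : ℕ} {p : MvPolynomial (Fin n) ℂ}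
    (hp : p.IsHomogeneous k) (hpJ : p ∉ J) {a b : MvPolynomial (Fin n) ℂ ⧸ J}
    (hab : Ideal.Quotient.mk J p = a * b) :
    ∃ (i j : ℕ) (A B : MvPolynomial (Fin n) ℂ), i + j = k ∧ A.IsHomogeneous i ∧
      B.IsHomogeneous j ∧ a = Ideal.Quotient.mk J A ∧ b = Ideal.Quotient.mk J B := by
  obtain ⟨A, rfl⟩ := Ideal.Quotient.mk_surjective a
  obtain ⟨B, rfl⟩ := Ideal.Quotient.mk_surjective b
  have hker : ∀ q ∈ J, gradingHom J q = 0 := fun q hq => by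
    ext d
    rw [coeff_gradingHom, Polynomial.coeff_zero, Ideal.Quotient.eq_zero_iff_mem]
    exact hJ q hq d
  have hprod : gradingHom J A * gradingHom J B =
      Polynomial.C (Ideal.Quotient.mk J p) * Polynomial.X ^ k := by
    rw [← gradingHom_of_isHomogeneous J hp, ← map_mul, ← sub_eq_zero, ← map_sub]
    refine hker _ ?_
    rw [← Ideal.Quotient.eq, map_mul, hab]
  have hp0 : Ideal.Quotient.mk J p ≠ 0 := fun h => hpJ (Ideal.Quotient.eq_zero_iff_mem.mp h)
  rw [Polynomial.C_mul_X_pow_eq_monomial] at hprod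
  have hne : gradingHom J A * gradingHom J B ≠ 0 := by
    rw [hprod, Ne, Polynomial.monomial_eq_zero_iff]
    exact hp0
  have hA := left_ne_zero_of_mul hne
  have hB := right_ne_zero_of_mul hne
  -- Over a domain both the degree and the trailing degree are additive. They agree on the monomial
  -- product, hence on each factor, so each factor is a monomial too.
  have h1 := Polynomial.natDegree_mul hA hB
  have h2 := Polynomial.natTrailingDegree_mul hA hB
  rw [hprod, Polynomial.natDegree_monomial_eq _ hp0] at h1
  rw [hprod, Polynomial.natTrailingDegree_monomial hp0] at h2
  have h3 := Polynomial.natTrailingDegree_le_natDegree (gradingHom J A)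
  have h4 := Polynomial.natTrailingDegree_le_natDegree (gradingHom J B)
  have key : ∀ q : MvPolynomial (Fin n) ℂ,
      (gradingHom J q).natTrailingDegree = (gradingHom J q).natDegree →
      Ideal.Quotient.mk J q =
        Ideal.Quotient.mk J (homogeneousComponent (gradingHom J q).natDegree q) := by
    intro q hq
    have hz : ∀ d ≠ (gradingHom J q).natDegree,
        Ideal.Quotient.mk J (homogeneousComponent d q) = 0 := by
      intro d hd
      rw [← coeff_gradingHom]
      rcases lt_or_gt_of_ne hd with h | h
      · exact Polynomial.coeff_eq_zero_of_lt_natTrailingDegree (hq ▸ h)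
      · exact Polynomial.coeff_eq_zero_of_natDegree_lt h
    conv_lhs => rw [← sum_homogeneousComponent q]
    rw [map_sum]
    refine Finset.sum_eq_single _ (fun d _ hd => hz d hd) fun h => ?_
    rw [homogeneousComponent_eq_zero _ _ (by rw [Finset.mem_range] at h; omega), map_zero]
  exact ⟨_, _, _, _, h1.symm, homogeneousComponent_isHomogeneous _ A,
    homogeneousComponent_isHomogeneous _ B, key A (by omega), key B (by omega)⟩

theorem exists_eq_C {p : MvPolynomial (Fin 6) ℂ} (hp : p.IsHomogeneous 0) : ∃ c, p = C c :=
  ⟨_, totalDegree_eq_zero_iff_eq_C.mp (Nat.le_zero.mp hp.totalDegree_le)⟩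

theorem constantCoeff_eq_zero {p : MvPolynomial (Fin 6) ℂ} {k : ℕ} (hp : p.IsHomogeneous k)
    (hk : k ≠ 0) : constantCoeff p = 0 := by
  rw [constantCoeff_eq]
  exact hp.coeff_eq_zero (by simpa using hk.symm)

/-! ### The coordinate ring of a smooth quadric -/

section

variable {G : Matrix (Fin 6) (Fin 6) ℂ}

theorem homogeneousComponent_mem_span (p : MvPolynomial (Fin 6) ℂ)
    (hp : p ∈ Ideal.span {quadricForm G}) (d : ℕ) :
    homogeneousComponent d p ∈ Ideal.span {quadricForm G} := by
  let _ : GradedAlgebra (homogeneousSubmodule (Fin 6) ℂ) := MvPolynomial.gradedAlgebra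
  have h : (Ideal.span {quadricForm G}).IsHomogeneous (homogeneousSubmodule (Fin 6) ℂ) := by
    refine Ideal.homogeneous_span _ _ ?_
    rintro _ rfl
    exact ⟨2, quadricForm_isHomogeneous _⟩
  rw [← decomposition.decompose'_apply]
  exact h d hp

/-- `G` has no constant term, so constant terms are well defined modulo `G`, and that of `p` is
zero. -/
theorem not_isUnit_mk {p : MvPolynomial (Fin 6) ℂ} {k : ℕ} (hp : p.IsHomogeneous k)
    (hk : k ≠ 0) : ¬ IsUnit (Ideal.Quotient.mk (Ideal.span {quadricForm G}) p) := by
  intro h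
  obtain ⟨b, hb⟩ := h.exists_right_inv
  obtain ⟨q, rfl⟩ := Ideal.Quotient.mk_surjective b
  rw [← map_mul, ← map_one (Ideal.Quotient.mk (Ideal.span {quadricForm G})), Ideal.Quotient.eq,
    Ideal.mem_span_singleton] at hb
  obtain ⟨c, hc⟩ := hb
  have := congrArg constantCoeff hc
  rw [map_sub, map_mul, map_mul, constantCoeff_eq_zero hp hk,
    constantCoeff_eq_zero (quadricForm_isHomogeneous G) two_ne_zero] at this
  simp at this

theorem quadricForm_ne_zero (hG : G.IsSymm) (hd : G.det ≠ 0) : quadricForm G ≠ 0 := by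
  intro h
  have h0 : G = 0 := quadricForm_inj hG (Matrix.transpose_zero) (by rw [h]; simp [quadricForm])
  rw [h0] at hd
  simp at hd

/-- Factoriality already includes cancellation; nontriviality follows because a coordinate is not a
unit. -/
theorem isPrime_span_quadricForm (hG : G.IsSymm) (hd : G.det ≠ 0) :
    (Ideal.span {quadricForm G}).IsPrime := by
  have := uniqueFactorizationMonoid_quotient hG hd
  have : Nontrivial (MvPolynomial (Fin 6) ℂ ⧸ Ideal.span {quadricForm G}) := by
    refine nontrivial_of_ne 1 0 fun h => ?_
    have h0 := not_isUnit_mk (G := G) (isHomogeneous_X ℂ (0 : Fin 6)) one_ne_zero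
    have := subsingleton_of_zero_eq_one h.symm
    exact h0 (isUnit_of_subsingleton _)
  have : IsDomain (MvPolynomial (Fin 6) ℂ ⧸ Ideal.span {quadricForm G}) := { }
  exact (Ideal.Quotient.isDomain_iff_prime _).mp this

theorem exists_C_mul_of_mem_span (hG : G.IsSymm) (hd : G.det ≠ 0) {p : MvPolynomial (Fin 6) ℂ}
    (hp : p ∈ Ideal.span {quadricForm G}) (h2 : p.totalDegree ≤ 2) :
    ∃ c, p = C c * quadricForm G := by
  obtain ⟨q, rfl⟩ := Ideal.mem_span_singleton.mp hp
  by_cases hq : q = 0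
  · exact ⟨0, by simp [hq]⟩
  · have hG0 := quadricForm_ne_zero hG hd
    rw [totalDegree_mul_of_isDomain hG0 hq, (quadricForm_isHomogeneous G).totalDegree hG0] at h2
    exact ⟨_, by rw [mul_comm, ← totalDegree_eq_zero_iff_eq_C.mp (by omega : q.totalDegree = 0)]⟩

theorem eq_zero_of_mem_span (hG : G.IsSymm) (hd : G.det ≠ 0) {p : MvPolynomial (Fin 6) ℂ}
    (hp : p ∈ Ideal.span {quadricForm G}) (h1 : p.totalDegree ≤ 1) : p = 0 := by
  obtain ⟨c, rfl⟩ := exists_C_mul_of_mem_span hG hd hp (h1.trans one_le_two)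
  by_contra h
  rw [((isHomogeneous_C _ _).mul (quadricForm_isHomogeneous G)).totalDegree h] at h1
  omega

theorem isUnit_mk_of_isHomogeneous_zero {p : MvPolynomial (Fin 6) ℂ} (hp : p.IsHomogeneous 0)
    (h0 : p ≠ 0) : IsUnit (Ideal.Quotient.mk (Ideal.span {quadricForm G}) p) := by
  obtain ⟨c, rfl⟩ := exists_eq_C hp
  refine RingHom.isUnit_map _ (RingHom.isUnit_map C ?_)
  exact isUnit_iff_ne_zero.mpr fun h => h0 (by rw [h, map_zero])

theorem linForm_notMem_span (hG : G.IsSymm) (hd : G.det ≠ 0) {l : Fin 6 → ℂ} (hl : l ≠ 0) :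
    linForm l ∉ Ideal.span {quadricForm G} := fun h =>
  hl (linForm_injective (by
    rw [eq_zero_of_mem_span hG hd h (linForm_isHomogeneous l).totalDegree_le, linForm_zero]))

/-- A nonzero linear form is prime in the coordinate ring of a smooth quadric in `ℙ⁵`. -/
theorem prime_mk_linForm (hG : G.IsSymm) (hd : G.det ≠ 0) {l : Fin 6 → ℂ} (hl : l ≠ 0) :
    Prime (Ideal.Quotient.mk (Ideal.span {quadricForm G}) (linForm l)) := by
  have := isPrime_span_quadricForm hG hd
  have := uniqueFactorizationMonoid_quotient hG hd
  rw [← UniqueFactorizationMonoid.irreducible_iff_prime]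
  refine ⟨not_isUnit_mk (linForm_isHomogeneous l) one_ne_zero, fun a b hab => ?_⟩
  have hmem := linForm_notMem_span hG hd hl
  obtain ⟨i, j, A, B, hij, hA, hB, rfl, rfl⟩ :=
    exists_homogeneous_factors homogeneousComponent_mem_span (linForm_isHomogeneous l) hmem hab
  have hne : Ideal.Quotient.mk (Ideal.span {quadricForm G}) A *
      Ideal.Quotient.mk (Ideal.span {quadricForm G}) B ≠ 0 := by
    rw [← hab]
    exact fun h => hmem (Ideal.Quotient.eq_zero_iff_mem.mp h)
  have hA0 : A ≠ 0 := by rintro rfl; simp at hne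
  have hB0 : B ≠ 0 := by rintro rfl; simp at hne
  obtain ⟨rfl, rfl⟩ | ⟨rfl, rfl⟩ : (i = 0 ∧ j = 1) ∨ (i = 1 ∧ j = 0) := by omega
  · exact Or.inl (isUnit_mk_of_isHomogeneous_zero hA hA0)
  · exact Or.inr (isUnit_mk_of_isHomogeneous_zero hB hB0)

/-- If no `F - c G` is a product of linear forms, then `F` is prime in the coordinate ring of the
smooth quadric `G`. -/
theorem prime_mk_quadricForm (hG : G.IsSymm) (hd : G.det ≠ 0) {F : Matrix (Fin 6) (Fin 6) ℂ}
    (hF : ∀ (c : ℂ) (l m : Fin 6 → ℂ),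
      quadricForm F ≠ C c * quadricForm G + linForm l * linForm m) :
    Prime (Ideal.Quotient.mk (Ideal.span {quadricForm G}) (quadricForm F)) := by
  have := isPrime_span_quadricForm hG hd
  have := uniqueFactorizationMonoid_quotient hG hd
  rw [← UniqueFactorizationMonoid.irreducible_iff_prime]
  refine ⟨not_isUnit_mk (quadricForm_isHomogeneous F) two_ne_zero, fun a b hab => ?_⟩
  have hmem : quadricForm F ∉ Ideal.span {quadricForm G} := fun h => by
    obtain ⟨c, hc⟩ := exists_C_mul_of_mem_span hG hd h (quadricForm_isHomogeneous F).totalDegree_le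
    exact hF c 0 0 (by rw [hc, linForm_zero]; simp)
  obtain ⟨i, j, A, B, hij, hA, hB, rfl, rfl⟩ :=
    exists_homogeneous_factors homogeneousComponent_mem_span (quadricForm_isHomogeneous F)
      hmem hab
  have hne : Ideal.Quotient.mk (Ideal.span {quadricForm G}) A *
      Ideal.Quotient.mk (Ideal.span {quadricForm G}) B ≠ 0 := by
    rw [← hab]
    exact fun h => hmem (Ideal.Quotient.eq_zero_iff_mem.mp h)
  have hA0 : A ≠ 0 := by rintro rfl; simp at hne
  have hB0 : B ≠ 0 := by rintro rfl; simp at hne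
  obtain ⟨rfl, rfl⟩ | ⟨rfl, rfl⟩ | ⟨rfl, rfl⟩ :
    (i = 0 ∧ j = 2) ∨ (i = 1 ∧ j = 1) ∨ (i = 2 ∧ j = 0) := by omega
  · exact Or.inl (isUnit_mk_of_isHomogeneous_zero hA hA0)
  · exfalso
    -- Two linear factors give `F - l m ∈ (G)`, and by degree this difference is a scalar multiple
    -- of `G`.
    obtain ⟨l, rfl⟩ := exists_linForm hA
    obtain ⟨m, rfl⟩ := exists_linForm hB
    rw [← map_mul, Ideal.Quotient.eq] at hab
    obtain ⟨c, hc⟩ := exists_C_mul_of_mem_span hG hd hab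
      ((quadricForm_isHomogeneous F).sub (hA.mul hB)).totalDegree_le
    exact hF c l m (by rw [← hc]; ring)
  · exact Or.inr (isUnit_mk_of_isHomogeneous_zero hB hB0)

/-- The cofactor is homogeneous of degree zero or one; degree one would make `l` a unit. This tells
when two linear forms are associated primes. -/
theorem exists_smul_of_mk_linForm_dvd (hG : G.IsSymm) (hd : G.det ≠ 0) {l m : Fin 6 → ℂ}
    (hm : m ≠ 0) (h : Ideal.Quotient.mk (Ideal.span {quadricForm G}) (linForm l) ∣
      Ideal.Quotient.mk (Ideal.span {quadricForm G}) (linForm m)) : ∃ c : ℂ, m = c • l := by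
  have := isPrime_span_quadricForm hG hd
  obtain ⟨b, hb⟩ := h
  have hmem := linForm_notMem_span hG hd hm
  obtain ⟨i, j, A, B, hij, hA, hB, hlA, rfl⟩ :=
    exists_homogeneous_factors homogeneousComponent_mem_span (linForm_isHomogeneous m) hmem hb
  have hA0 : A ≠ 0 := by
    rintro rfl
    rw [hlA, map_zero, zero_mul, Ideal.Quotient.eq_zero_iff_mem] at hb
    exact hmem hb
  obtain ⟨rfl, rfl⟩ | ⟨rfl, rfl⟩ : (i = 0 ∧ j = 1) ∨ (i = 1 ∧ j = 0) := by omega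
  · exact absurd (hlA ▸ isUnit_mk_of_isHomogeneous_zero hA hA0)
      (not_isUnit_mk (linForm_isHomogeneous l) one_ne_zero)
  · obtain ⟨c, rfl⟩ := exists_eq_C hB
    refine ⟨c, linForm_injective ?_⟩
    rw [← map_mul, Ideal.Quotient.eq] at hb
    have h1 : (linForm m - linForm l * C c).IsHomogeneous 1 :=
      (linForm_isHomogeneous m).sub ((linForm_isHomogeneous l).mul (isHomogeneous_C _ _))
    have := eq_zero_of_mem_span hG hd hb h1.totalDegree_le
    rw [linForm_smul, sub_eq_zero.mp this, mul_comm]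

/-- A prime element of the coordinate ring does not divide all the coordinates. -/
theorem exists_not_dvd_mk_X (hG : G.IsSymm) (hd : G.det ≠ 0)
    {p : MvPolynomial (Fin 6) ℂ ⧸ Ideal.span {quadricForm G}} (hp : Prime p) :
    ∃ i, ¬ p ∣ Ideal.Quotient.mk (Ideal.span {quadricForm G}) (X i) := by
  by_contra! h
  have := isPrime_span_quadricForm hG hd
  have hs : ∀ i : Fin 6, (Pi.single i 1 : Fin 6 → ℂ) ≠ 0 := fun i => by simp
  have h0 := h 0
  have h1 := h 1
  rw [← linForm_single] at h0 h1
  -- A common prime divisor of the primes `x₀` and `x₁` would be associated to `x₀`, making `x₁`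
  -- proportional to `x₀`.
  have a0 := hp.associated_of_dvd (prime_mk_linForm hG hd (hs 0)) h0
  obtain ⟨c, hc⟩ := exists_smul_of_mk_linForm_dvd hG hd (hs 1) (a0.symm.dvd.trans h1)
  simpa using congrFun hc 1

end

end QuadricPencil
end

noncomputable section
-- Reducedness and irreducibility of `Proj` from the graded ring.
namespace AlgebraicGeometry.Proj

variable {A σ : Type*} [CommRing A] [SetLike σ A] [AddSubgroupClass σ A] (𝒜 : ℕ → σ)
  [GradedRing 𝒜]

/-- `Proj` of a reduced graded ring is reduced. -/
theorem isReduced_of_isReduced [_root_.IsReduced A] : IsReduced (Proj 𝒜) := by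
  have h : ∀ i, IsReduced ((affineOpenCover 𝒜).openCover.X i) := fun i => by
    change IsReduced (Spec (CommRingCat.of (HomogeneousLocalization.Away 𝒜 (i.2 : A))))
    rw [affine_isReduced_iff]
    exact isReduced_of_injective (algebraMap (HomogeneousLocalization.Away 𝒜 (i.2 : A))
      (Localization.Away (i.2 : A))) (HomogeneousLocalization.val_injective _)
  exact IsReduced.of_openCover _ (affineOpenCover 𝒜).openCover

/-- `Proj` is not reduced if `t ∈ 𝒜 1` and if some element of degree one, not annihilated by any
power of `t`, has square zero. -/
theorem not_isReduced {t l : A} (ht : t ∈ 𝒜 1) (hl : l ∈ 𝒜 1) (h2 : l ^ 2 = 0)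
    (h : ∀ k, t ^ k * l ≠ 0) : ¬ IsReduced (Proj 𝒜) := by
  intro hred
  have h1 := isReduced_of_isOpenImmersion (awayι 𝒜 t ht one_pos)
  rw [affine_isReduced_iff] at h1
  replace h1 : _root_.IsReduced (HomogeneousLocalization.Away 𝒜 t) := h1
  -- On the chart `t ≠ 0`, the function `l / t` has square zero, and it vanishes only if a power of
  -- `t` kills `l`.
  set z := HomogeneousLocalization.Away.mk 𝒜 ht 1 l (by simpa using hl) with hz
  have hz2 : z ^ 2 = 0 := by
    apply HomogeneousLocalization.val_injective
    rw [HomogeneousLocalization.val_pow, hz, HomogeneousLocalization.Away.val_mk,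
      Localization.mk_pow, h2, Localization.mk_zero, HomogeneousLocalization.val_zero]
  have hz0 : z.val = 0 := by
    rw [eq_zero_of_pow_eq_zero hz2, HomogeneousLocalization.val_zero]
  rw [hz, HomogeneousLocalization.Away.val_mk, Localization.mk_eq_mk',
    IsLocalization.mk'_eq_zero_iff] at hz0
  obtain ⟨⟨_, k, rfl⟩, hk⟩ := hz0
  exact h k hk

/-- `Proj` is irreducible if the nilradical is prime and if some element of positive degree is not
nilpotent. -/
theorem irreducibleSpace (hp : (nilradical A).IsPrime) {t : A} {d : ℕ} (ht : t ∈ 𝒜 d)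
    (hd : d ≠ 0) (hn : ¬ IsNilpotent t) : IrreducibleSpace (Proj 𝒜) := by
  have hhom : (nilradical A).IsHomogeneous 𝒜 := (Ideal.IsHomogeneous.bot 𝒜).radical
  -- The nilradical lies in every prime, so it is a generic point; `t` shows that it does not
  -- contain the irrelevant ideal.
  let η : ProjectiveSpectrum 𝒜 := ⟨⟨nilradical A, hhom⟩, hp, fun hle => by
    refine hn (mem_nilradical.mp (hle (?_ : t ∈ HomogeneousIdeal.irrelevant 𝒜)))
    rw [HomogeneousIdeal.mem_irrelevant_iff, GradedRing.proj_apply,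
      DirectSum.decompose_of_mem_ne 𝒜 ht hd]⟩
  have hη : closure {η} = Set.univ := by
    refine Set.eq_univ_of_forall fun x => ?_
    rw [← ProjectiveSpectrum.le_iff_mem_closure]
    change nilradical A ≤ x.asHomogeneousIdeal.toIdeal
    exact nilradical_le_prime _
  have h1 : IsIrreducible (Set.univ : Set (ProjectiveSpectrum 𝒜)) := by
    rw [← hη]
    exact isIrreducible_singleton.closure
  exact (irreducibleSpace_def (ProjectiveSpectrum 𝒜)).mpr h1

/-- The ideal `P` is itself a point of the open set: `t` lies in the irrelevant ideal but not in
`P`. -/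
theorem basicOpen_nonempty (P : HomogeneousIdeal 𝒜) (hP : P.toIdeal.IsPrime) {t : A} {d : ℕ}
    (ht : t ∈ 𝒜 d) (hd : d ≠ 0) (htP : t ∉ P) :
    (ProjectiveSpectrum.basicOpen 𝒜 t : Set (ProjectiveSpectrum 𝒜)).Nonempty := by
  refine ⟨⟨P, hP, fun hle => htP (hle ?_)⟩, htP⟩
  rw [HomogeneousIdeal.mem_irrelevant_iff, GradedRing.proj_apply,
      DirectSum.decompose_of_mem_ne 𝒜 ht hd]

/-- `Proj` is reducible if there are two elements with product zero that both do not vanish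
somewhere. -/
theorem not_irreducibleSpace {a b : A} (hab : a * b = 0)
    (ha : (ProjectiveSpectrum.basicOpen 𝒜 a : Set (ProjectiveSpectrum 𝒜)).Nonempty)
    (hb : (ProjectiveSpectrum.basicOpen 𝒜 b : Set (ProjectiveSpectrum 𝒜)).Nonempty) :
    ¬ IrreducibleSpace (Proj 𝒜) := by
  intro h
  have h1 : IsIrreducible (Set.univ : Set (ProjectiveSpectrum 𝒜)) :=
    (irreducibleSpace_def (ProjectiveSpectrum 𝒜)).mp h
  obtain ⟨x, -, hx⟩ := h1.isPreirreducible _ _ (ProjectiveSpectrum.basicOpen 𝒜 a).isOpen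
    (ProjectiveSpectrum.basicOpen 𝒜 b).isOpen (by simpa using ha) (by simpa using hb)
  have h2 : x ∈ ProjectiveSpectrum.basicOpen 𝒜 (a * b) := by
    rw [ProjectiveSpectrum.basicOpen_mul]
    exact hx
  rw [hab, ProjectiveSpectrum.basicOpen_zero] at h2
  exact h2

end AlgebraicGeometry.Proj

/-! ### The geometry of the complex according to the ranks in the pencil. -/

namespace QuadraticComplex

open MvPolynomial QuadricPencil AlgebraicGeometry

variable (X : QuadraticComplex)

/-- Membership in the ideal of `F ∩ G` in terms of a member of the pencil different from `G`. -/
theorem mem_ideal_iff {a : ℂ} (ha : a ≠ 0) (b : ℂ) (f : MvPolynomial (Fin 6) ℂ) :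
    f ∈ X.ideal ↔
      Ideal.Quotient.mk (Ideal.span {quadricForm X.G}) (quadricForm (X.member a b)) ∣
        Ideal.Quotient.mk (Ideal.span {quadricForm X.G}) f := by
  have hF : quadricForm (X.member a b) = C a * quadricForm X.F + C b * quadricForm X.G := by
    rw [member, quadricForm_add, quadricForm_smul, quadricForm_smul]
  have hC : (C a⁻¹ : MvPolynomial (Fin 6) ℂ) * C a = 1 := by
    rw [← map_mul, inv_mul_cancel₀ ha, map_one]
  rw [ideal, Ideal.mem_span_pair]
  constructor
  · rintro ⟨u, v, rfl⟩
    refine ⟨Ideal.Quotient.mk _ (C a⁻¹ * u), ?_⟩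
    rw [← map_mul, Ideal.Quotient.eq, Ideal.mem_span_singleton]
    refine ⟨v - C b * C a⁻¹ * u, ?_⟩
    rw [hF]
    linear_combination (-u * quadricForm X.F) * hC
  · rintro ⟨g, hg⟩
    obtain ⟨u, rfl⟩ := Ideal.Quotient.mk_surjective g
    rw [← map_mul, Ideal.Quotient.eq, Ideal.mem_span_singleton] at hg
    obtain ⟨v, hv⟩ := hg
    refine ⟨C a * u, v + C b * u, ?_⟩
    rw [hF] at hv
    linear_combination -hv

/-- The polynomials that vanish in the homogeneous coordinate ring of `F ∩ G`. -/
theorem mk_eq_zero_iff {a : ℂ} (ha : a ≠ 0) (b : ℂ) (f : MvPolynomial (Fin 6) ℂ) :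
    Ideal.Quotient.mk X.ideal f = 0 ↔
      Ideal.Quotient.mk (Ideal.span {quadricForm X.G}) (quadricForm (X.member a b)) ∣
        Ideal.Quotient.mk (Ideal.span {quadricForm X.G}) f := by
  rw [Ideal.Quotient.eq_zero_iff_mem, X.mem_ideal_iff ha b]

/-- If the radical of the ideal of `F ∩ G` is generated modulo `G` by a prime element, then
`F ∩ G` is irreducible. -/
theorem not_isReducible {p : MvPolynomial (Fin 6) ℂ ⧸ Ideal.span {quadricForm X.G}}
    (hp : Prime p) (h : ∀ f, IsNilpotent (Ideal.Quotient.mk X.ideal f) ↔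
      p ∣ Ideal.Quotient.mk (Ideal.span {quadricForm X.G}) f) : ¬ X.IsReducible := by
  rw [IsReducible, not_not]
  obtain ⟨i, hi⟩ := exists_not_dvd_mk_X X.G_symm X.G_smooth hp
  refine Proj.irreducibleSpace (quotientGrading X.ideal) ?_
    (mk_mem_quotientGrading X.ideal (isHomogeneous_X ℂ i)) one_ne_zero (fun hn => hi ((h _).mp hn))
  constructor
  · rw [Ne, Ideal.eq_top_iff_one, mem_nilradical, ← map_one (Ideal.Quotient.mk X.ideal), h,
      map_one]
    exact hp.not_dvd_one
  · intro x y hxy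
    obtain ⟨f, rfl⟩ := Ideal.Quotient.mk_surjective x
    obtain ⟨g, rfl⟩ := Ideal.Quotient.mk_surjective y
    rw [mem_nilradical, ← map_mul, h, map_mul] at hxy
    rw [mem_nilradical, mem_nilradical, h, h]
    exact hp.dvd_or_dvd hxy

theorem not_isNonReduced (h : X.ideal.IsRadical) : ¬ X.IsNonReduced := by
  rw [IsNonReduced, not_not]
  have := (Ideal.isRadical_iff_quotient_reduced _).mp h
  exact Proj.isReduced_of_isReduced (quotientGrading X.ideal)

/-- If all members of the pencil have rank at least three, then `F ∩ G` is integral. -/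
theorem of_two_lt_rank (h : ∀ a b : ℂ, a ≠ 0 → 2 < (X.member a b).rank) :
    ¬ X.IsNonReduced ∧ ¬ X.IsReducible := by
  have hmem : X.member 1 0 = X.F := by simp [member]
  have hprime : Prime (Ideal.Quotient.mk (Ideal.span {quadricForm X.G}) (quadricForm X.F)) := by
    refine prime_mk_quadricForm X.G_symm X.G_smooth fun c l m hF => ?_
    -- `F = c G + l m` says that the member `F - c G` is a product of linear forms.
    have h1 := h 1 (-c) one_ne_zero
    rw [← not_le, rank_le_two_iff (X.member_isSymm _ _)] at h1
    refine h1 ⟨l, m, ?_⟩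
    rw [member, quadricForm_add, quadricForm_smul, quadricForm_smul, hF, map_neg, map_one]
    ring
  have key : ∀ f n, Ideal.Quotient.mk X.ideal f ^ n = 0 →
      Ideal.Quotient.mk (Ideal.span {quadricForm X.G}) (quadricForm X.F) ∣
        Ideal.Quotient.mk (Ideal.span {quadricForm X.G}) f := by
    intro f n hn
    rw [← map_pow, X.mk_eq_zero_iff one_ne_zero 0, hmem, map_pow] at hn
    exact hprime.dvd_of_dvd_pow hn
  constructor
  · refine X.not_isNonReduced fun f hf => ?_
    obtain ⟨n, hn⟩ := hf
    rw [X.mem_ideal_iff one_ne_zero 0, hmem]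
    exact key f n (by rw [← map_pow]; exact Ideal.Quotient.eq_zero_iff_mem.mpr hn)
  · refine X.not_isReducible hprime fun f => ⟨fun ⟨n, hn⟩ => key f n hn, fun hf => ⟨1, ?_⟩⟩
    rwa [pow_one, X.mk_eq_zero_iff one_ne_zero 0, hmem]

/-- The only place where it matters that the two quadrics are different. -/
theorem member_ne_zero {a : ℂ} (ha : a ≠ 0) (b : ℂ) : quadricForm (X.member a b) ≠ 0 := by
  intro h
  have h0 : X.member a b = 0 :=
    quadricForm_inj (X.member_isSymm _ _) Matrix.transpose_zero (by rw [h]; simp [quadricForm])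
  refine X.F_ne (-(a⁻¹ * b)) ?_
  have := congrArg (fun M => a⁻¹ • M) h0
  simp only [member, smul_add, smul_smul, inv_mul_cancel₀ ha, one_smul, smul_zero] at this
  rw [neg_smul]
  exact eq_neg_of_add_eq_zero_left this

/-- If the pencil has a member of rank one, then `F ∩ G` is non-reduced and irreducible. -/
theorem of_rank_one {a : ℂ} (ha : a ≠ 0) (b : ℂ) (h : (X.member a b).rank ≤ 1) :
    X.IsNonReduced ∧ ¬ X.IsReducible := by
  obtain ⟨l, hl⟩ := (rank_le_one_iff (X.member_isSymm a b)).mp h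
  have hl0 : l ≠ 0 := by
    rintro rfl
    exact X.member_ne_zero ha b (by rw [hl, linForm_zero]; simp)
  have hp := prime_mk_linForm X.G_symm X.G_smooth hl0
  have := isPrime_span_quadricForm X.G_symm X.G_smooth
  set p := Ideal.Quotient.mk (Ideal.span {quadricForm X.G}) (linForm l) with hpdef
  have hz : ∀ f, Ideal.Quotient.mk X.ideal f = 0 ↔
      p ^ 2 ∣ Ideal.Quotient.mk (Ideal.span {quadricForm X.G}) f := fun f => by
    rw [X.mk_eq_zero_iff ha b, hl, map_pow]
  constructor
  · obtain ⟨i, hi⟩ := exists_not_dvd_mk_X X.G_symm X.G_smooth hp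
    -- The class of `l` has square zero. If `xᵢ ^ k * l` were zero, `l ^ 2` would divide it in `S`,
    -- and so `l` would divide `xᵢ`.
    refine Proj.not_isReduced (quotientGrading X.ideal)
      (mk_mem_quotientGrading X.ideal (isHomogeneous_X ℂ i))
      (mk_mem_quotientGrading X.ideal (linForm_isHomogeneous l)) ?_ fun k hk => ?_
    · rw [← map_pow, hz, map_pow]
    · rw [← map_pow, ← map_mul, hz, map_mul, map_pow, pow_two,
        mul_dvd_mul_iff_right hp.ne_zero] at hk
      exact hi (hp.dvd_of_dvd_pow hk)
  · refine X.not_isReducible hp fun f => ⟨fun ⟨n, hn⟩ => ?_, fun hf => ⟨2, ?_⟩⟩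
    · rw [← map_pow, hz, map_pow] at hn
      exact hp.dvd_of_dvd_pow ((dvd_pow_self p two_ne_zero).trans hn)
    · rw [← map_pow, hz, map_pow]
      exact pow_dvd_pow_of_dvd hf 2

/-- If a member of the pencil is a product of two linear forms `l` and `m`, with `l` not
proportional to `m`, then `l` does not vanish on all of `F ∩ G`. -/
theorem basicOpen_linForm_nonempty {a : ℂ} (ha : a ≠ 0) (b : ℂ) {l m : Fin 6 → ℂ}
    (h : quadricForm (X.member a b) = linForm l * linForm m) (hl : l ≠ 0)
    (hlm : ∀ c : ℂ, l ≠ c • m) :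
    (ProjectiveSpectrum.basicOpen (quotientGrading X.ideal)
      (Ideal.Quotient.mk X.ideal (linForm l)) :
        Set (ProjectiveSpectrum (quotientGrading X.ideal))).Nonempty := by
  have hm0 : m ≠ 0 := by
    rintro rfl
    exact X.member_ne_zero ha b (by rw [h, linForm_zero]; simp)
  have hp := prime_mk_linForm X.G_symm X.G_smooth hm0
  -- Since `m` divides the member `l m`, passing from `S` to its quotient does not change
  -- divisibility by `m`.
  have hdvd : ∀ f, Ideal.Quotient.mk X.ideal f ∈
      Ideal.span {Ideal.Quotient.mk X.ideal (linForm m)} ↔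
      Ideal.Quotient.mk (Ideal.span {quadricForm X.G}) (linForm m) ∣
        Ideal.Quotient.mk (Ideal.span {quadricForm X.G}) f := by
    intro f
    rw [Ideal.mem_span_singleton]
    constructor
    · rintro ⟨g, hg⟩
      obtain ⟨g, rfl⟩ := Ideal.Quotient.mk_surjective g
      rw [← sub_eq_zero, ← map_mul, ← map_sub, X.mk_eq_zero_iff ha b, h, map_mul, map_sub,
        map_mul] at hg
      exact (dvd_sub_left (dvd_mul_right _ _)).mp ((dvd_mul_left _ _).trans hg)
    · rintro ⟨g, hg⟩
      obtain ⟨g, rfl⟩ := Ideal.Quotient.mk_surjective g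
      refine ⟨Ideal.Quotient.mk _ g, ?_⟩
      rw [← sub_eq_zero, ← map_mul, ← map_sub, X.mk_eq_zero_iff ha b, map_sub, map_mul, ← hg,
        sub_self]
      exact dvd_zero _
  -- The generic point of the component `m = 0`, at which `l` does not vanish.
  let P : HomogeneousIdeal (quotientGrading X.ideal) :=
    ⟨Ideal.span {Ideal.Quotient.mk X.ideal (linForm m)},
      Ideal.homogeneous_span _ _ (by
        rintro _ rfl
        exact ⟨1, mk_mem_quotientGrading X.ideal (linForm_isHomogeneous m)⟩)⟩
  have hP : P.toIdeal.IsPrime := by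
    change (Ideal.span {Ideal.Quotient.mk X.ideal (linForm m)}).IsPrime
    constructor
    · rw [Ne, Ideal.eq_top_iff_one, ← map_one (Ideal.Quotient.mk X.ideal), hdvd, map_one]
      exact hp.not_dvd_one
    · intro x y hxy
      obtain ⟨f, rfl⟩ := Ideal.Quotient.mk_surjective x
      obtain ⟨g, rfl⟩ := Ideal.Quotient.mk_surjective y
      rw [← map_mul, hdvd, map_mul] at hxy
      rw [hdvd, hdvd]
      exact hp.dvd_or_dvd hxy
  refine Proj.basicOpen_nonempty _ P hP
    (mk_mem_quotientGrading X.ideal (linForm_isHomogeneous l)) one_ne_zero fun hmem => ?_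
  obtain ⟨c, hc⟩ := exists_smul_of_mk_linForm_dvd X.G_symm X.G_smooth hl ((hdvd _).mp hmem)
  exact hlm c hc

/-- If the pencil has a member of rank two, then `F ∩ G` is reduced and reducible. -/
theorem of_rank_two {a : ℂ} (ha : a ≠ 0) (b : ℂ) (h : (X.member a b).rank = 2) :
    ¬ X.IsNonReduced ∧ X.IsReducible := by
  obtain ⟨l, m, hlm⟩ := (rank_le_two_iff (X.member_isSymm a b)).mp h.le
  have hsq : ∀ (c : ℂ) (k : Fin 6 → ℂ), quadricForm (X.member a b) ≠ C c * linForm k ^ 2 := by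
    intro c k hk
    obtain ⟨n, hn⟩ := C_mul_linForm_sq c k
    have := (rank_le_one_iff (X.member_isSymm a b)).mpr ⟨n, hk.trans hn⟩
    omega
  have hl : ∀ c : ℂ, l ≠ c • m := fun c hc =>
    hsq c m (by rw [hlm, hc, linForm_smul]; ring)
  have hm : ∀ c : ℂ, m ≠ c • l := fun c hc =>
    hsq c l (by rw [hlm, hc, linForm_smul]; ring)
  have hl0 : l ≠ 0 := by simpa using hl 0
  have hm0 : m ≠ 0 := by simpa using hm 0
  constructor
  · refine X.not_isNonReduced fun f hf => ?_
    obtain ⟨n, hn⟩ := hf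
    have hpl := prime_mk_linForm X.G_symm X.G_smooth hl0
    have hpm := prime_mk_linForm X.G_symm X.G_smooth hm0
    rw [X.mem_ideal_iff ha b, hlm, map_mul] at hn ⊢
    rw [map_pow] at hn
    obtain ⟨g, hg⟩ := hpl.dvd_of_dvd_pow ((dvd_mul_right _ _).trans hn)
    have h2 := hpm.dvd_of_dvd_pow ((dvd_mul_left _ _).trans hn)
    rw [hg] at h2 ⊢
    -- The primes `l` and `m` are not associated, so `m` divides the cofactor of `l` and `l m`
    -- generates a radical ideal.
    refine mul_dvd_mul_left _ ((hpm.dvd_or_dvd h2).resolve_left fun h3 => ?_)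
    obtain ⟨c, hc⟩ := exists_smul_of_mk_linForm_dvd X.G_symm X.G_smooth hl0 h3
    exact hl c hc
  · refine Proj.not_irreducibleSpace (quotientGrading X.ideal)
      (a := Ideal.Quotient.mk X.ideal (linForm l)) (b := Ideal.Quotient.mk X.ideal (linForm m))
      ?_ (X.basicOpen_linForm_nonempty ha b hlm hl0 hl)
      (X.basicOpen_linForm_nonempty ha b (hlm.trans (mul_comm _ _)) hm0 hm)
    rw [← map_mul, X.mk_eq_zero_iff ha b, hlm]

theorem rank_member_ne_zero {a : ℂ} (ha : a ≠ 0) (b : ℂ) : (X.member a b).rank ≠ 0 := by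
  intro h
  obtain ⟨w, P, hw, hQ⟩ := exists_diagonalization_rank (X.member_isSymm a b)
  rw [h, Finset.card_eq_zero, Finset.filter_eq_empty_iff] at hw
  refine X.member_ne_zero ha b ?_
  rw [hQ]
  refine Finset.sum_eq_zero fun i hi => ?_
  rw [not_not.mp (hw hi), map_zero, zero_mul]

end QuadraticComplex
end

theorem lemma4p1 (X : QuadraticComplex) :
    (X.IsNonReduced ↔ ∃ b ∈ X.segreSymbol, b.length = 5) ∧
      (X.IsReducible ↔ ∃ b ∈ X.segreSymbol, b.length = 4) := by
  have e5 := X.exists_bracket_iff (k := 1) (by norm_num)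
  have e4 := X.exists_bracket_iff (k := 2) (by norm_num)
  norm_num only at e5 e4
  rw [e5, e4]
  by_cases h1 : ∃ a b : ℂ, a ≠ 0 ∧ (X.member a b).rank = 1
  · obtain ⟨a, b, ha, hr⟩ := h1
    have hc := X.of_rank_one ha b hr.le
    refine ⟨iff_of_true hc.1 ⟨a, b, ha, hr⟩, iff_of_false hc.2 ?_⟩
    rintro ⟨a', b', ha', hr'⟩
    -- Ranks one and two cannot both occur: one forces non-reducedness, the other reducedness.
    exact (X.of_rank_two ha' b' hr').1 hc.1
  · by_cases h2 : ∃ a b : ℂ, a ≠ 0 ∧ (X.member a b).rank = 2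
    · obtain ⟨a, b, ha, hr⟩ := id h2
      have hc := X.of_rank_two ha b hr
      exact ⟨iff_of_false hc.1 h1, iff_of_true hc.2 h2⟩
    · have hc := X.of_two_lt_rank fun a b ha => by
        have h0 := X.rank_member_ne_zero ha b
        have h1' : (X.member a b).rank ≠ 1 := fun h => h1 ⟨a, b, ha, h⟩
        have h2' : (X.member a b).rank ≠ 2 := fun h => h2 ⟨a, b, ha, h⟩
        omega
      exact ⟨iff_of_false hc.1 h1, iff_of_false hc.2 h2⟩
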